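/- **Definitions.** By a *complex* we mean a 2-complex with triangle faces. It is of *rank $7/4$* if the link of every vertex is isomorphic to the Möbius–Kantor graph. It is *compact* if it has finitely many cells. Link edges have length $\pi/3$. A *root* at a vertex $x$ is an isometric embedding $\alpha\colon[0,\pi]\to L_x$ into the link of $x$ such that $\alpha(0)$ is a link vertex; its *rank* is $1+N(\alpha)/q_\alpha$, where $N(\alpha)$ is the number of roots $\beta\neq\alpha$ at $x$ with the same end points as $\alpha$, and $q_\alpha$ is the valency of $\alpha(0)$ minus $1$. In a complex of rank $7/4$, a *2-triangle* with centerpiece a face $t$ is obtained by choosing along each of the three sides of $t$ another face; each of its three sides defines a root at its midpoint. The face $t$ is *even* if the number of the three sides whose root has rank $2$ is even for a 2-triangle with centerpiece $t$ (this does not depend on the 2-triangle), and *odd* otherwise. For a simply connected complex $X$ of rank $7/4$, the *radius of evenness* $e(X)\in\mathbb N\cup\{\infty\}$ is the supremum of the integers $r\ge 0$ such that for some vertex $x$ all faces of the ball $B(x,r)$ are even; here $B(x,r)$ is the subcomplex spanned by the vertices at distance at most $r$ from $x$ in the 1-skeleton. A list of triples of labels denotes the complex obtained from oriented triangles with labeled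 edges by identifying the edges respecting the labels and the orientations. Let $C$ be the complex $$(x,a,d),\ (y,c,d),\ (z,c,b),\ (x',d,a),\ (y',b,a),\ (z',b,c),$$ let $X_{00}$ be the complex $$(x,a,d),(y,c,d),(z,c,b),(1,1,2),(2,a',d'),(4,c',d'),(3,c',b'),$$ $$(4,d,a),(3,b,a),(2,b,c),(1,3,4),(x',d',a'),(y',b',a'),(z',b',c'),$$ and let $Y_{00}$ be the complex $$(x,a,d),(y,c,d),(z,c,b),(1,2,3),(4,a',d'),(2,c',d'),(1,c',b'),$$ $$(1,d,a),(3,b,a),(4,b,c),(2,4,3),(x',d',a'),(y',b',a'),(z',b',c').$$ Each of them contains a left and a right copy of $C$. The left copy is given by the identity on the labels $x,y,z,a,b,c,d$ and by $(x',y',z')\mapsto(4,3,2)$ for $X_{00}$, $(x',y',z')\mapsto(1,3,4)$ for $Y_{00}$. The right copy is given by $(a,b,c,d,x',y',z')\mapsto(a',b',c',d',x',y',z')$ and by $(x,y,z)\mapsto(2,4,3)$ for $X_{00}$, $(x,y,z)\mapsto(4,2,1)$ for $Y_{00}$. For $n\ge 0$ let $$V_n:=X_{00}\underbrace{Y_{00}\cdots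 Y_{00}}_{2n}/\sim$$ be obtained from one copy of $X_{00}$ followed by $2n$ copies of $Y_{00}$ by identifying the right copy of $C$ in each term with the left copy of $C$ in the next one, and the right copy of $C$ in the last term with the left copy of $C$ in the first one. **Theorem.** There are infinitely many compact complexes of rank $7/4$ whose universal covers are pairwise non-isomorphic. More precisely, every $V_n$ is a compact complex of rank $7/4$ and has a universal cover $X_n$; one has $n-1\le e(X_n)<\infty$; and there is an infinite set $S\subset\mathbb N$ such that $X_m$ and $X_n$ are not isomorphic (as complexes) for distinct $m,n\in S$. -/

import Mathlib

/-! ### 2-complexes with triangular faces -/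

/-- A 2-complex with triangle faces (loops, multiple edges, and several corners of a face at the same
vertex are allowed). `Dart` is the set of oriented edges. `Flag` is the set of faces together with an
orientation and a distinguished side: every face has six flags, which form one free orbit of the
symmetric group `S₃` acting through `rot` (pass to the next side) and `flip` (same side, reversed
orientation). -/
structure TriangleComplex where
  Vert : Type
  Dart : Type
  Flag : Type
  src : Dart → Vert
  rev : Dart → Dart
  rev_rev : ∀ d, rev (rev d) = d
  rev_ne : ∀ d, rev d ≠ d
  /-- the distinguished side, oriented by the orientation of the face -/
  edge : Flag → Dart
  rot : Flag → Flag
  flip : Flag → Flag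
  rot_rot_rot : ∀ f, rot (rot (rot f)) = f
  rot_ne : ∀ f, rot f ≠ f
  flip_flip : ∀ f, flip (flip f) = f
  flip_rot : ∀ f, flip (rot f) = rot (rot (flip f))
  edge_flip : ∀ f, edge (flip f) = rev (edge f)
  src_edge_rot : ∀ f, src (edge (rot f)) = src (rev (edge f))

/-! ### The Möbius–Kantor graph, roots and their rank -/

/-- The Möbius–Kantor graph: a cycle of length 16 with a chord from each even `i` to `i + 5`. -/
def moebiusKantor : SimpleGraph (ZMod 16) :=
  SimpleGraph.fromRel fun i j => j = i + 1 ∨ (Even i.val ∧ j = i + 5)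

namespace SimpleGraph

variable {W : Type} (L : SimpleGraph W)

/-- Roots of a graph `L` whose edges have length `π / 3`: isometric embeddings of `[0, π]` in `L` that
start at a vertex. Such a root is an edge path of length 3 between two vertices at distance 3. -/
def IsRoot (α : Fin 4 → W) : Prop :=
  L.Adj (α 0) (α 1) ∧ L.Adj (α 1) (α 2) ∧ L.Adj (α 2) (α 3) ∧ L.dist (α 0) (α 3) = 3

/-- The rank `1 + N(α) / q_α` of a root `α`, where `N(α)` is the number of the other roots with the
same end points as `α`, and `q_α` is the valency of `α 0` minus 1. -/
noncomputable def rootRank (α : Fin 4 → W) : ℚ :=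
  1 + (Set.ncard {β | L.IsRoot β ∧ β ≠ α ∧ β 0 = α 0 ∧ β 3 = α 3} : ℚ) /
    ((L.neighborSet (α 0)).ncard - 1)

end SimpleGraph

namespace TriangleComplex

/-! ### Links and complexes of rank 7/4 -/

/-- The disjoint union of the links of all vertices. Two oriented edges with the same origin are
adjacent if they bound a corner of a face. -/
def linkGraph (K : TriangleComplex) : SimpleGraph K.Dart where
  Adj d d' := d ≠ d' ∧ ∃ f, K.rev (K.edge f) = d ∧ K.edge (K.rot f) = d'
  symm := ⟨by
    rintro d d' ⟨hne, f, rfl, rfl⟩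
    refine ⟨hne.symm, K.flip (K.rot f), ?_, ?_⟩
    · rw [K.edge_flip, K.rev_rev]
    · rw [K.flip_rot, K.rot_rot_rot, K.edge_flip]⟩
  loopless := ⟨fun _ h => h.1 rfl⟩

/-- The link of the vertex `v`. -/
def link (K : TriangleComplex) (v : K.Vert) : SimpleGraph {d : K.Dart | K.src d = v} :=
  K.linkGraph.induce {d | K.src d = v}

/-- `K` is a complex of rank `7/4`: its links are isomorphic to the Möbius–Kantor graph. The first two
clauses say that links have no loops and no multiple edges, which `link` does not record. -/
structure IsRankSevenFourths (K : TriangleComplex) : Prop where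
  no_loop : ∀ f, K.rev (K.edge f) ≠ K.edge (K.rot f)
  no_multiple : ∀ f g, K.edge f = K.edge g → K.edge (K.rot f) = K.edge (K.rot g) → f = g
  link_iso : ∀ v, Nonempty (K.link v ≃g moebiusKantor)

/-- `K` is compact: it has finitely many cells. -/
def IsCompact (K : TriangleComplex) : Prop :=
  Finite K.Vert ∧ Finite K.Dart ∧ Finite K.Flag

/-! ### Maps, paths, universal covers -/

/-- Simplicial maps, mapping vertices to vertices, edges to edges and faces to faces. -/
structure Hom (K K' : TriangleComplex) where
  vert : K.Vert → K'.Vert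
  dart : K.Dart → K'.Dart
  flag : K.Flag → K'.Flag
  src_dart : ∀ d, K'.src (dart d) = vert (K.src d)
  rev_dart : ∀ d, K'.rev (dart d) = dart (K.rev d)
  edge_flag : ∀ f, K'.edge (flag f) = dart (K.edge f)
  rot_flag : ∀ f, K'.rot (flag f) = flag (K.rot f)
  flip_flag : ∀ f, K'.flip (flag f) = flag (K.flip f)

/-- Simplicial isomorphism of complexes. -/
def IsIsomorphic (K K' : TriangleComplex) : Prop :=
  ∃ p : Hom K K', p.vert.Bijective ∧ p.dart.Bijective ∧ p.flag.Bijective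

/-- Covering maps: surjective, and bijective on the edges at every vertex and on the faces along every
edge. -/
structure Hom.IsCovering {K K' : TriangleComplex} (p : Hom K K') : Prop where
  surjective : p.vert.Surjective
  lift_dart : ∀ x d', K'.src d' = p.vert x → ∃! d, K.src d = x ∧ p.dart d = d'
  lift_flag : ∀ d f', K'.edge f' = p.dart d → ∃! f, K.edge f = d ∧ p.flag f = f'

/-- `l` is an edge path from `x` to `y`. -/
def IsPath (K : TriangleComplex) (x : K.Vert) : List K.Dart → K.Vert → Prop
  | [], y => x = y
  | d :: l, y => K.src d = x ∧ K.IsPath (K.src (K.rev d)) l y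

/-- Elementary reductions: removing a backtracking, or the boundary of a face. -/
inductive Reduction (K : TriangleComplex) : List K.Dart → List K.Dart → Prop
  | backtrack (l m : List K.Dart) (d : K.Dart) :
      Reduction K (l ++ d :: K.rev d :: m) (l ++ m)
  | face (l m : List K.Dart) (f : K.Flag) :
      Reduction K (l ++ K.edge f :: K.edge (K.rot f) :: K.edge (K.rot (K.rot f)) :: m) (l ++ m)

/-- Homotopy, with fixed end points, of edge paths from `x` to `y`. -/
def Homotopic (K : TriangleComplex) (x y : K.Vert) : List K.Dart → List K.Dart → Prop :=
  Relation.EqvGen fun l m => K.IsPath x l y ∧ K.IsPath x m y ∧ K.Reduction l m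

/-- `K` is non-empty, connected, and its edge-path groups are trivial. -/
structure IsSimplyConnected (K : TriangleComplex) : Prop where
  nonempty : Nonempty K.Vert
  connected : ∀ x y, ∃ l, K.IsPath x l y
  homotopic_nil : ∀ x l, K.IsPath x l x → K.Homotopic x x l []

/-- A universal cover of `K`: a simply connected complex with a covering map to `K`. -/
structure UniversalCover (K : TriangleComplex) where
  total : TriangleComplex
  proj : Hom total K
  isCovering : proj.IsCovering
  isSimplyConnected : total.IsSimplyConnected

/-! ### Parity and the radius of evenness -/

/-- A 2-triangle whose centerpiece is the face of `f`: the choice, for each of the three sides of this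
face, of another face along that side. -/
structure TwoTriangle (K : TriangleComplex) (f : K.Flag) where
  outer : Fin 3 → K.Flag
  edge_outer : ∀ i, K.edge (outer i) = K.edge (K.rot^[i] f)
  outer_ne : ∀ i, outer i ≠ K.rot^[i] f

/-- The path of length 3 defined by a side of a 2-triangle in the link of its midpoint, which is the
terminal vertex of the `i`-th side of the centerpiece. -/
def TwoTriangle.side {K : TriangleComplex} {f : K.Flag} (T : K.TwoTriangle f) (i : Fin 3) :
    Fin 4 → K.Dart :=
  ![K.edge (K.rot (T.outer i)), K.rev (K.edge (K.rot^[i] f)), K.edge (K.rot^[i + 1] f),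
    K.rev (K.edge (K.rot (K.rot (T.outer (i + 1)))))]

/-- The number of roots of rank 2 in a 2-triangle. -/
noncomputable def TwoTriangle.numRankTwo {K : TriangleComplex} {f : K.Flag}
    (T : K.TwoTriangle f) : ℕ :=
  Set.ncard {i | K.linkGraph.IsRoot (T.side i) ∧ K.linkGraph.rootRank (T.side i) = 2}

/-- The face of `f` is even: the number of roots of rank 2 in a 2-triangle with centerpiece `f` is even.
In a complex of rank `7/4` its parity does not depend on the 2-triangle. -/
def IsEvenFace (K : TriangleComplex) (f : K.Flag) : Prop :=
  ∀ T : K.TwoTriangle f, Even T.numRankTwo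

/-- The vertices at distance at most `r` from `x` in the 1-skeleton. -/
def ball (K : TriangleComplex) (x : K.Vert) (r : ℕ) : Set K.Vert :=
  {y | ∃ l, K.IsPath x l y ∧ l.length ≤ r}

/-- All faces of the simplicial ball `B(x, r)` (the subcomplex spanned by the vertices at distance at
most `r` from `x`) are even. -/
def IsEvenBall (K : TriangleComplex) (x : K.Vert) (r : ℕ) : Prop :=
  ∀ f : K.Flag, K.src (K.edge f) ∈ K.ball x r → K.src (K.edge (K.rot f)) ∈ K.ball x r →
    K.src (K.edge (K.rot (K.rot f))) ∈ K.ball x r → K.IsEvenFace f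

/-- The radius of evenness `e(K)`, the largest radius of an even ball (or `⊤`). -/
noncomputable def evennessRadius (K : TriangleComplex) : ℕ∞ :=
  ⨆ r ∈ {r : ℕ | ∃ x, K.IsEvenBall x r}, (r : ℕ∞)

/-! ### Complexes given by labeled triangles -/

/-- The complex obtained from a set `T` of oriented triangles with labeled edges by identifying the
edges respecting the labels and the orientations. The oriented edge `(e, true)` is the edge with label
`e`, and `(e, false)` is its reverse; `((t, i), true)` is the triangle `t` with its orientation and its
`i`-th side distinguished. -/
def ofTriangles {E : Type} (T : Set (Fin 3 → E)) : TriangleComplex where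
  Vert := Quot fun d d' : E × Bool =>
    ∃ t ∈ T, ∃ i : Fin 3, d = (t i, false) ∧ d' = (t (i + 1), true)
  Dart := E × Bool
  Flag := (T × Fin 3) × Bool
  src d := Quot.mk _ d
  rev d := (d.1, !d.2)
  rev_rev d := by simp
  rev_ne d h := by simpa using congrArg Prod.snd h
  edge f := (f.1.1.1 f.1.2, f.2)
  rot f := ((f.1.1, if f.2 then f.1.2 + 1 else f.1.2 - 1), f.2)
  flip f := (f.1, !f.2)
  rot_rot_rot := by
    rintro ⟨⟨t, i⟩, b⟩
    cases b <;> fin_cases i <;> rfl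
  rot_ne := by
    rintro ⟨⟨t, i⟩, b⟩ h
    have h2 := congrArg (fun f => f.1.2) h
    revert h2
    cases b <;> fin_cases i <;> simp
  flip_flip f := by simp
  flip_rot := by
    rintro ⟨⟨t, i⟩, b⟩
    cases b <;> fin_cases i <;> rfl
  edge_flip f := rfl
  src_edge_rot := by
    rintro ⟨⟨t, i⟩, b⟩
    cases b
    · refine Quot.sound ⟨t.1, t.2, i - 1, rfl, ?_⟩
      simp
    · exact (Quot.sound ⟨t.1, t.2, i, rfl, rfl⟩).symm

end TriangleComplex

/-! ### Group cobordisms and the complexes `V n` -/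

/-- Labels of the edges of the collar. -/
inductive CollarEdge
  | x | y | z | x' | y' | z' | a | b | c | d

/-- The triangles of the collar `C`. -/
def collarFaces : Set (Fin 3 → CollarEdge) :=
  {![.x, .a, .d], ![.y, .c, .d], ![.z, .c, .b], ![.x', .d, .a], ![.y', .b, .a], ![.z', .b, .c]}

theorem comp_triple {E E' : Type} (g : E → E') (s t u : E) : g ∘ ![s, t, u] = ![g s, g t, g u] := by
  ext i
  fin_cases i <;> rfl

/-- A cobordism `C → C`, presented by triangles with edges labeled by `E`, with two copies of the
collar `C` in it. -/
structure Cobordism (E : Type) where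
  faces : Set (Fin 3 → E)
  left : CollarEdge → E
  right : CollarEdge → E
  left_injective : left.Injective
  right_injective : right.Injective
  left_faces : ∀ t ∈ collarFaces, left ∘ t ∈ faces
  right_faces : ∀ t ∈ collarFaces, right ∘ t ∈ faces

/-- Labels of the edges of the cobordisms `X₀₀` and `Y₀₀`; `e1, e2, e3, e4` are the core edges. -/
inductive CobordismEdge
  | x | y | z | a | b | c | d | x' | y' | z' | a' | b' | c' | d' | e1 | e2 | e3 | e4

/-- The left copy of the collar in `X₀₀`. -/
def leftX : CollarEdge → CobordismEdge
  | .x => .x | .y => .y | .z => .z | .x' => .e4 | .y' => .e3 | .z' => .e2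
  | .a => .a | .b => .b | .c => .c | .d => .d

/-- The right copy of the collar in `X₀₀`. -/
def rightX : CollarEdge → CobordismEdge
  | .x => .e2 | .y => .e4 | .z => .e3 | .x' => .x' | .y' => .y' | .z' => .z'
  | .a => .a' | .b => .b' | .c => .c' | .d => .d'

/-- The left copy of the collar in `Y₀₀`. -/
def leftY : CollarEdge → CobordismEdge
  | .x => .x | .y => .y | .z => .z | .x' => .e1 | .y' => .e3 | .z' => .e4
  | .a => .a | .b => .b | .c => .c | .d => .d

/-- The right copy of the collar in `Y₀₀`. -/
def rightY : CollarEdge → CobordismEdge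
  | .x => .e4 | .y => .e2 | .z => .e1 | .x' => .x' | .y' => .y' | .z' => .z'
  | .a => .a' | .b => .b' | .c => .c' | .d => .d'

/-- The cobordism `X₀₀`. -/
def cobordismX : Cobordism CobordismEdge where
  faces :=
    {![.x, .a, .d], ![.y, .c, .d], ![.z, .c, .b], ![.e1, .e1, .e2],
      ![.e2, .a', .d'], ![.e4, .c', .d'], ![.e3, .c', .b'],
      ![.e4, .d, .a], ![.e3, .b, .a], ![.e2, .b, .c], ![.e1, .e3, .e4],
      ![.x', .d', .a'], ![.y', .b', .a'], ![.z', .b', .c']}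
  left := leftX
  right := rightX
  left_injective := by intro s t; cases s <;> cases t <;> simp [leftX]
  right_injective := by intro s t; cases s <;> cases t <;> simp [rightX]
  left_faces := by
    rintro t (rfl | rfl | rfl | rfl | rfl | rfl) <;> simp [leftX, comp_triple]
  right_faces := by
    rintro t (rfl | rfl | rfl | rfl | rfl | rfl) <;> simp [rightX, comp_triple]

/-- The cobordism `Y₀₀`. -/
def cobordismY : Cobordism CobordismEdge where
  faces :=
    {![.x, .a, .d], ![.y, .c, .d], ![.z, .c, .b], ![.e1, .e2, .e3],
      ![.e4, .a', .d'], ![.e2, .c', .d'], ![.e1, .c', .b'],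
      ![.e1, .d, .a], ![.e3, .b, .a], ![.e4, .b, .c], ![.e2, .e4, .e3],
      ![.x', .d', .a'], ![.y', .b', .a'], ![.z', .b', .c']}
  left := leftY
  right := rightY
  left_injective := by intro s t; cases s <;> cases t <;> simp [leftY]
  right_injective := by intro s t; cases s <;> cases t <;> simp [rightY]
  left_faces := by
    rintro t (rfl | rfl | rfl | rfl | rfl | rfl) <;> simp [leftY, comp_triple]
  right_faces := by
    rintro t (rfl | rfl | rfl | rfl | rfl | rfl) <;> simp [rightY, comp_triple]

/-- The edges of the closed composition `Z₀ Z₁ ⋯ Z_{N-1} / ∼`: the right copy of the collar in each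
cobordism is identified with the left copy in the next one, cyclically. -/
def GluedEdge {E : Type} {N : ℕ} (Z : ZMod N → Cobordism E) : Type :=
  Quot fun p q : ZMod N × E => ∃ i s, p = (i, (Z i).right s) ∧ q = (i + 1, (Z (i + 1)).left s)

/-- The closed composition `Z₀ Z₁ ⋯ Z_{N-1} / ∼` of cobordisms, where `∼` identifies the two extremal
copies of the collar. -/
def closedComposition {E : Type} {N : ℕ} (Z : ZMod N → Cobordism E) : TriangleComplex :=
  TriangleComplex.ofTriangles (E := GluedEdge Z)
    {t | ∃ i, ∃ u ∈ (Z i).faces, t = fun k => Quot.mk _ (i, u k)}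

/-- The complex `V n = X₀₀ Y₀₀ ⋯ Y₀₀ / ∼`, with `2 n` factors `Y₀₀`. -/
def surgeryComplex (n : ℕ) : TriangleComplex :=
  closedComposition fun i : ZMod (2 * n + 1) => if i = 0 then cobordismX else cobordismY

/-!
The radius of evenness of a complex is invariant under isomorphism. It is finite for every universal
cover of `V n`, with a bound that depends only on `n`, and it is at least `n - 1`; hence an increasing
sequence of numbers `n`, each of which exceeds the bounds for the preceding ones, gives pairwise
non-isomorphic universal covers.

*Coordinates.* In a cyclic composition of copies of `X₀₀` and `Y₀₀` every collar edge `x, y, z, x', y', z'`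
is a core edge `e1, …, e4` of an adjacent term. The composition thus has eight edges and eight faces for
every term, and it has one vertex for every term: the core edges of a term are loops at its vertex, and
the edges `a, b, c, d` of its left collar join this vertex to the preceding one. This is the complex
`necklace c`, and `necklace.toComposition` is an isomorphism. Each of the sixteen pairs of an edge label
and an orientation occurs exactly once at every vertex, and the link of a vertex depends only on the type
of its term. The isomorphism of this link with the Möbius–Kantor graph (`linkCoord`) is checked by a
finite computation.

*Parity.* All links, roots and ranks are transported by maps that restrict to isomorphisms of connected
components (`SimpleGraph.IsComponentIso`), for instance by coverings, so that coverings preserve the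
parity of faces. In the Möbius–Kantor graph a path of length 3 is a root of rank 2 if and only if its end
points belong to an explicit list of pairs. It follows, by a finite computation, that a face all of whose
vertices correspond to terms `Y₀₀` is even (`necklace.isEvenFace`), while there is an odd face along the
term `X₀₀` (`necklace.exists_odd_face`).

*Radii.* An edge moves the number of a vertex by at most 1, so that the ball of radius `n - 1` around the
vertex `n` of `V n`, and around any of its lifts, does not meet the vertex of the term `X₀₀`; this gives
the lower bound. Since `V n` is finite and connected, a path of bounded length leads from each of its
vertices to an odd face; it lifts to every covering, which gives the upper bound.

*Universal covers.* The universal cover consists of the homotopy classes of edge paths from a base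
vertex (`TriangleComplex.pathCover`). It is simply connected because homotopies lift to coverings.
-/

/-! ### Roots in graphs -/

namespace SimpleGraph

variable {V W : Type} {G : SimpleGraph V} {H : SimpleGraph W}

theorem three_le_length {u v : V} (p : G.Walk u v) (h0 : u ≠ v) (h1 : ¬ G.Adj u v)
    (h2 : ∀ c, G.Adj u c → ¬ G.Adj c v) : 3 ≤ p.length := by
  match p with
  | .nil => exact absurd rfl h0
  | .cons e .nil => exact absurd e h1
  | .cons e (.cons e' .nil) => exact absurd e' (h2 _ e)
  | .cons _ (.cons _ (.cons _ _)) => simp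

theorem isRoot_iff (α : Fin 4 → V) :
    G.IsRoot α ↔ G.Adj (α 0) (α 1) ∧ G.Adj (α 1) (α 2) ∧ G.Adj (α 2) (α 3) ∧
      α 0 ≠ α 3 ∧ ¬ G.Adj (α 0) (α 3) ∧ ∀ c, G.Adj (α 0) c → ¬ G.Adj c (α 3) := by
  unfold IsRoot
  refine and_congr_right fun h1 => and_congr_right fun h2 => and_congr_right fun h3 => ?_
  have hle : G.dist (α 0) (α 3) ≤ 3 := dist_le (.cons h1 (.cons h2 (.cons h3 .nil)))
  constructor
  · intro h
    refine ⟨?_, ?_, ?_⟩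
    · intro e
      rw [e, dist_self] at h
      omega
    · intro e
      rw [dist_eq_one_iff_adj.2 e] at h
      omega
    · intro c e1 e2
      have := dist_le (.cons e1 (.cons e2 .nil))
      rw [h] at this
      simp at this
  · rintro ⟨n0, n1, n2⟩
    refine le_antisymm hle ?_
    obtain ⟨p, hp⟩ := Reachable.exists_walk_length_eq_dist
      (⟨.cons h1 (.cons h2 (.cons h3 .nil))⟩ : G.Reachable (α 0) (α 3))
    rw [← hp]
    exact three_le_length p n0 n1 n2

/-- The map `φ` restricts to an isomorphism from the union `A` of connected components of `G` onto a
union of connected components of `H`. -/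
structure IsComponentIso (G : SimpleGraph V) (H : SimpleGraph W) (A : Set V) (φ : V → W) : Prop where
  injOn : Set.InjOn φ A
  mem_of_adj : ∀ {a b}, a ∈ A → G.Adj a b → b ∈ A
  map_adj : ∀ {a b}, a ∈ A → G.Adj a b → H.Adj (φ a) (φ b)
  lift_adj : ∀ {a w}, a ∈ A → H.Adj (φ a) w → ∃ b, G.Adj a b ∧ φ b = w

namespace IsComponentIso

variable {A : Set V} {φ : V → W} (h : IsComponentIso G H A φ)
include h

theorem adj_iff {a b : V} (ha : a ∈ A) (hb : b ∈ A) : H.Adj (φ a) (φ b) ↔ G.Adj a b := by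
  refine ⟨fun e => ?_, h.map_adj ha⟩
  obtain ⟨b', hb', e'⟩ := h.lift_adj ha e
  rwa [← h.injOn (h.mem_of_adj ha hb') hb e']

theorem isRoot_comp {α : Fin 4 → V} (hα : ∀ i, α i ∈ A) : H.IsRoot (φ ∘ α) ↔ G.IsRoot α := by
  simp only [isRoot_iff, Function.comp, h.adj_iff (hα _) (hα _), ne_eq, (h.injOn.eq_iff (hα _) (hα _))]
  refine and_congr_right fun _ => and_congr_right fun _ => and_congr_right fun _ =>
    and_congr_right fun _ => and_congr_right fun _ => ?_
  constructor
  · intro hc c h1 h2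
    exact hc _ (h.map_adj (hα 0) h1) ((h.adj_iff (h.mem_of_adj (hα 0) h1) (hα 3)).2 h2)
  · intro hc w h1 h2
    obtain ⟨c, h3, rfl⟩ := h.lift_adj (hα 0) h1
    exact hc c h3 ((h.adj_iff (h.mem_of_adj (hα 0) h3) (hα 3)).1 h2)

theorem mem_of_isRoot {β : Fin 4 → V} (h0 : β 0 ∈ A) (hβ : G.IsRoot β) (i : Fin 4) : β i ∈ A := by
  have h1 := h.mem_of_adj h0 hβ.1
  have h2 := h.mem_of_adj h1 hβ.2.1
  have h3 := h.mem_of_adj h2 hβ.2.2.1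
  fin_cases i <;> assumption

theorem exists_comp_eq {a : V} (ha : a ∈ A) {γ : Fin 4 → W} (h0 : γ 0 = φ a) (hγ : H.IsRoot γ) :
    ∃ β : Fin 4 → V, (∀ i, β i ∈ A) ∧ φ ∘ β = γ := by
  obtain ⟨e1, e2, e3, -⟩ := hγ
  rw [h0] at e1
  obtain ⟨b1, g1, e1'⟩ := h.lift_adj ha e1
  have m1 := h.mem_of_adj ha g1
  rw [← e1'] at e2
  obtain ⟨b2, g2, e2'⟩ := h.lift_adj m1 e2
  have m2 := h.mem_of_adj m1 g2
  rw [← e2'] at e3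
  obtain ⟨b3, g3, e3'⟩ := h.lift_adj m2 e3
  have m3 := h.mem_of_adj m2 g3
  refine ⟨![a, b1, b2, b3], ?_, ?_⟩
  · intro i
    fin_cases i <;> assumption
  · ext i
    fin_cases i
    exacts [h0.symm, e1', e2', e3']

theorem rootRank_comp {α : Fin 4 → V} (hα : ∀ i, α i ∈ A) :
    H.rootRank (φ ∘ α) = G.rootRank α := by
  have e1 : {γ | H.IsRoot γ ∧ γ ≠ φ ∘ α ∧ γ 0 = (φ ∘ α) 0 ∧ γ 3 = (φ ∘ α) 3} =
      (fun β => φ ∘ β) '' {β | G.IsRoot β ∧ β ≠ α ∧ β 0 = α 0 ∧ β 3 = α 3} := by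
    ext γ
    constructor
    · rintro ⟨hγ, hne, h0, h3⟩
      obtain ⟨β, hβ, rfl⟩ := h.exists_comp_eq (hα 0) h0 hγ
      refine ⟨β, ⟨(h.isRoot_comp hβ).1 hγ, ?_, h.injOn (hβ _) (hα _) h0,
        h.injOn (hβ _) (hα _) h3⟩, rfl⟩
      rintro rfl
      exact hne rfl
    · rintro ⟨β, ⟨hr, hne, h0, h3⟩, rfl⟩
      have hβ := h.mem_of_isRoot (h0 ▸ hα 0) hr
      refine ⟨(h.isRoot_comp hβ).2 hr, fun e => hne ?_, congrArg φ h0, congrArg φ h3⟩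
      ext i
      exact h.injOn (hβ i) (hα i) (congrFun e i)
  have i1 : Set.InjOn (fun β : Fin 4 → V => φ ∘ β)
      {β | G.IsRoot β ∧ β ≠ α ∧ β 0 = α 0 ∧ β 3 = α 3} := by
    rintro β ⟨hr, -, h0, -⟩ β' ⟨hr', -, h0', -⟩ e
    ext i
    exact h.injOn (h.mem_of_isRoot (h0 ▸ hα 0) hr i) (h.mem_of_isRoot (h0' ▸ hα 0) hr' i)
      (congrFun e i)
  have e2 : H.neighborSet ((φ ∘ α) 0) = φ '' G.neighborSet (α 0) := by
    ext w
    constructor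
    · intro hw
      obtain ⟨b, hb, rfl⟩ := h.lift_adj (hα 0) hw
      exact ⟨b, hb, rfl⟩
    · rintro ⟨b, hb, rfl⟩
      exact h.map_adj (hα 0) hb
  have i2 : Set.InjOn φ (G.neighborSet (α 0)) :=
    h.injOn.mono fun b hb => h.mem_of_adj (hα 0) hb
  unfold rootRank
  rw [e1, i1.ncard_image, e2, i2.ncard_image]

/-- A component isomorphism, as a graph isomorphism onto the components that it reaches. -/
theorem nonempty_iso {B : Set W} (hB : φ '' A = B) : Nonempty (G.induce A ≃g H.induce B) := by
  subst hB
  exact ⟨⟨Equiv.Set.imageOfInjOn φ A h.injOn, fun {a b} => h.adj_iff a.2 b.2⟩⟩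

end IsComponentIso

end SimpleGraph

namespace TriangleComplex

variable {K K' K'' : TriangleComplex}

/-! ### Edge paths and homotopies -/

theorem isPath_append {x y : K.Vert} {l m : List K.Dart} :
    K.IsPath x (l ++ m) y ↔ ∃ z, K.IsPath x l z ∧ K.IsPath z m y := by
  induction l generalizing x with
  | nil => simp [IsPath]
  | cons d l ih => simp [IsPath, ih, and_assoc]

theorem IsPath.append {x y z : K.Vert} {l m : List K.Dart} (h : K.IsPath x l y)
    (h' : K.IsPath y m z) : K.IsPath x (l ++ m) z :=
  isPath_append.2 ⟨y, h, h'⟩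

theorem isPath_singleton {x y : K.Vert} {d : K.Dart} :
    K.IsPath x [d] y ↔ K.src d = x ∧ K.src (K.rev d) = y :=
  Iff.rfl

theorem IsPath.unique {x y z : K.Vert} {l : List K.Dart} (h : K.IsPath x l y)
    (h' : K.IsPath x l z) : y = z := by
  induction l generalizing x with
  | nil => exact Eq.trans (Eq.symm h) h'
  | cons d l ih => exact ih h.2 h'.2

/-- The reverse of an edge path. -/
def reversePath (K : TriangleComplex) (l : List K.Dart) : List K.Dart :=
  (l.map K.rev).reverse

theorem IsPath.reverse {x y : K.Vert} {l : List K.Dart} (h : K.IsPath x l y) :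
    K.IsPath y (K.reversePath l) x := by
  induction l generalizing x with
  | nil => exact Eq.symm h
  | cons d l ih =>
    have := ih h.2
    simp only [reversePath, List.map_cons, List.reverse_cons] at this ⊢
    refine this.append ⟨rfl, ?_⟩
    rw [K.rev_rev]
    exact h.1

theorem Homotopic.trans {x y : K.Vert} {l m k : List K.Dart} (h : K.Homotopic x y l m)
    (h' : K.Homotopic x y m k) : K.Homotopic x y l k :=
  Relation.EqvGen.trans _ _ _ h h'

theorem Homotopic.symm {x y : K.Vert} {l m : List K.Dart} (h : K.Homotopic x y l m) :
    K.Homotopic x y m l :=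
  Relation.EqvGen.symm _ _ h

theorem Homotopic.refl (x y : K.Vert) (l : List K.Dart) : K.Homotopic x y l l :=
  Relation.EqvGen.refl _

theorem Reduction.append {l m : List K.Dart} (h : K.Reduction l m) (j k : List K.Dart) :
    K.Reduction (j ++ l ++ k) (j ++ m ++ k) := by
  cases h with
  | backtrack l m d => simpa using Reduction.backtrack (j ++ l) (m ++ k) d
  | face l m f => simpa using Reduction.face (j ++ l) (m ++ k) f

theorem Homotopic.append {w x y z : K.Vert} {l m j k : List K.Dart} (h : K.Homotopic x y l m)
    (hj : K.IsPath w j x) (hk : K.IsPath y k z) : K.Homotopic w z (j ++ l ++ k) (j ++ m ++ k) := by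
  induction h with
  | rel l m h =>
    exact .rel _ _ ⟨(hj.append h.1).append hk, (hj.append h.2.1).append hk, h.2.2.append j k⟩
  | refl l => exact .refl _ _ _
  | symm l m _ ih => exact .symm ih
  | trans l m n _ _ ih ih' => exact .trans ih ih'

/-- A reduction of a path is a path with the same end points. -/
theorem Reduction.isPath {x y : K.Vert} {l m : List K.Dart} (h : K.Reduction l m)
    (hl : K.IsPath x l y) : K.IsPath x m y := by
  cases h with
  | backtrack l m d =>
    obtain ⟨z, h1, h2, -, h3⟩ := isPath_append.1 hl
    rw [K.rev_rev, h2] at h3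
    exact h1.append h3
  | face l m f =>
    obtain ⟨z, h1, h2, -, -, h3⟩ := isPath_append.1 hl
    rw [← K.src_edge_rot, K.rot_rot_rot, h2] at h3
    exact h1.append h3

theorem homotopic_reversePath_append {x y : K.Vert} {l : List K.Dart} (h : K.IsPath x l y) :
    K.Homotopic y y (K.reversePath l ++ l) [] := by
  induction l generalizing x with
  | nil => exact .refl _ _ _
  | cons d l ih =>
    refine .trans (.rel _ _ ?_) (ih h.2)
    have e : K.reversePath (d :: l) ++ d :: l =
        K.reversePath l ++ K.rev d :: K.rev (K.rev d) :: l := by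
      simp [reversePath, K.rev_rev]
    have hr : K.Reduction (K.reversePath (d :: l) ++ d :: l) (K.reversePath l ++ l) := by
      rw [e]
      exact .backtrack _ _ _
    have hp := h.reverse.append h
    exact ⟨hp, hr.isPath hp, hr⟩

/-! ### Maps of complexes and lifting -/

namespace Hom

theorem tgt_dart (p : Hom K K') (d : K.Dart) :
    K'.src (K'.rev (p.dart d)) = p.vert (K.src (K.rev d)) := by
  rw [p.rev_dart, p.src_dart]

theorem isPath_map (p : Hom K K') {x y : K.Vert} {l : List K.Dart} (h : K.IsPath x l y) :
    K'.IsPath (p.vert x) (l.map p.dart) (p.vert y) := by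
  induction l generalizing x with
  | nil => exact congrArg p.vert h
  | cons d l ih =>
    refine ⟨?_, ?_⟩
    · rw [p.src_dart, h.1]
    · rw [p.tgt_dart]
      exact ih h.2

/-- The composition of two maps of complexes. -/
def comp (q : Hom K' K'') (p : Hom K K') : Hom K K'' where
  vert := q.vert ∘ p.vert
  dart := q.dart ∘ p.dart
  flag := q.flag ∘ p.flag
  src_dart d := by simp [q.src_dart, p.src_dart]
  rev_dart d := by simp [q.rev_dart, p.rev_dart]
  edge_flag f := by simp [q.edge_flag, p.edge_flag]
  rot_flag f := by simp [q.rot_flag, p.rot_flag]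
  flip_flag f := by simp [q.flip_flag, p.flip_flag]

/-- The inverse of a bijective map of complexes. -/
noncomputable def symm (p : Hom K K') (hv : p.vert.Bijective) (hd : p.dart.Bijective)
    (hf : p.flag.Bijective) : Hom K' K where
  vert := (Equiv.ofBijective _ hv).symm
  dart := (Equiv.ofBijective _ hd).symm
  flag := (Equiv.ofBijective _ hf).symm
  src_dart d := by
    obtain ⟨d, rfl⟩ := hd.2 d
    rw [p.src_dart, Equiv.ofBijective_symm_apply_apply, Equiv.ofBijective_symm_apply_apply]
  rev_dart d := by
    obtain ⟨d, rfl⟩ := hd.2 d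
    rw [p.rev_dart, Equiv.ofBijective_symm_apply_apply, Equiv.ofBijective_symm_apply_apply]
  edge_flag f := by
    obtain ⟨f, rfl⟩ := hf.2 f
    rw [p.edge_flag, Equiv.ofBijective_symm_apply_apply, Equiv.ofBijective_symm_apply_apply]
  rot_flag f := by
    obtain ⟨f, rfl⟩ := hf.2 f
    rw [p.rot_flag, Equiv.ofBijective_symm_apply_apply, Equiv.ofBijective_symm_apply_apply]
  flip_flag f := by
    obtain ⟨f, rfl⟩ := hf.2 f
    rw [p.flip_flag, Equiv.ofBijective_symm_apply_apply, Equiv.ofBijective_symm_apply_apply]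

theorem isCovering_of_bijective (p : Hom K K') (hv : p.vert.Bijective) (hd : p.dart.Bijective)
    (hf : p.flag.Bijective) : p.IsCovering where
  surjective := hv.2
  lift_dart x d' h := by
    obtain ⟨d, rfl⟩ := hd.2 d'
    exact ⟨d, ⟨hv.1 (by rw [← p.src_dart, h]), rfl⟩, fun e he => hd.1 he.2⟩
  lift_flag d f' h := by
    obtain ⟨f, rfl⟩ := hf.2 f'
    exact ⟨f, ⟨hd.1 (by rw [← p.edge_flag, h]), rfl⟩, fun e he => hf.1 he.2⟩

namespace IsCovering

theorem comp {q : Hom K' K''} {p : Hom K K'} (hq : q.IsCovering) (hp : p.IsCovering) :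
    (q.comp p).IsCovering where
  surjective := hq.surjective.comp hp.surjective
  lift_dart x d'' h := by
    obtain ⟨d', ⟨h1, h2⟩, hu'⟩ := hq.lift_dart (p.vert x) d'' h
    obtain ⟨d, ⟨h3, h4⟩, hu⟩ := hp.lift_dart x d' h1
    refine ⟨d, ⟨h3, (congrArg q.dart h4).trans h2⟩, ?_⟩
    rintro e ⟨he1, he2⟩
    exact hu e ⟨he1, hu' _ ⟨by rw [p.src_dart, he1], he2⟩⟩
  lift_flag d f'' h := by
    obtain ⟨f', ⟨h1, h2⟩, hu'⟩ := hq.lift_flag (p.dart d) f'' h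
    obtain ⟨f, ⟨h3, h4⟩, hu⟩ := hp.lift_flag d f' h1
    refine ⟨f, ⟨h3, (congrArg q.flag h4).trans h2⟩, ?_⟩
    rintro e ⟨he1, he2⟩
    exact hu e ⟨he1, hu' _ ⟨by rw [p.edge_flag, he1], he2⟩⟩

variable {p : Hom K K'} (hp : p.IsCovering)
include hp

theorem dart_injOn (x : K.Vert) : Set.InjOn p.dart {d | K.src d = x} := by
  intro d hd d' hd' h
  refine (hp.lift_dart x (p.dart d) ?_).unique ⟨hd, rfl⟩ ⟨hd', h.symm⟩
  rw [p.src_dart, hd]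

theorem flag_inj {f g : K.Flag} (he : K.edge f = K.edge g) (h : p.flag f = p.flag g) : f = g := by
  refine (hp.lift_flag (K.edge f) (p.flag f) ?_).unique ⟨rfl, rfl⟩ ⟨he.symm, h.symm⟩
  rw [p.edge_flag]

theorem lift_path {x : K.Vert} {l' : List K'.Dart} {y' : K'.Vert}
    (h : K'.IsPath (p.vert x) l' y') : ∃ l y, K.IsPath x l y ∧ l.map p.dart = l' ∧ p.vert y = y' := by
  induction l' generalizing x with
  | nil => exact ⟨[], x, rfl, rfl, h⟩
  | cons d' l' ih =>
    obtain ⟨d, ⟨h1, rfl⟩, -⟩ := hp.lift_dart x d' h.1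
    have h2 := h.2
    rw [p.tgt_dart] at h2
    obtain ⟨l, y, hl, rfl, hy⟩ := ih h2
    exact ⟨d :: l, y, ⟨h1, hl⟩, rfl, hy⟩

/-- Lifts of edge paths with a given origin are unique. -/
theorem path_inj {x y z : K.Vert} {l m : List K.Dart} (hl : K.IsPath x l y) (hm : K.IsPath x m z)
    (h : l.map p.dart = m.map p.dart) : l = m := by
  induction l generalizing x m with
  | nil => simpa using h.symm
  | cons d l ih =>
    cases m with
    | nil => simp at h
    | cons e m =>
      simp only [List.map_cons, List.cons.injEq] at h
      obtain rfl := hp.dart_injOn x hl.1 hm.1 h.1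
      rw [ih hl.2 hm.2 h.2]

/-- Elementary reductions lift to a covering, in both directions. -/
theorem lift_reduction {x z : K.Vert} {y' : K'.Vert} {l' m' : List K'.Dart}
    (hl' : K'.IsPath (p.vert x) l' y') (h : K'.Reduction l' m') :
    (∀ L, K.IsPath x L z → L.map p.dart = l' →
      ∃ M, K.IsPath x M z ∧ M.map p.dart = m' ∧ K.Homotopic x z L M) ∧
    (∀ M, K.IsPath x M z → M.map p.dart = m' →
      ∃ L, K.IsPath x L z ∧ L.map p.dart = l' ∧ K.Homotopic x z M L) := by
  -- It suffices to lift the larger path and to recognize its lift as reducible.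
  suffices key : ∀ w L, K.IsPath x L w → L.map p.dart = l' →
      ∃ M, K.Reduction L M ∧ M.map p.dart = m' by
    constructor
    · intro L hL e
      obtain ⟨M, hr, hM⟩ := key _ L hL e
      exact ⟨M, hr.isPath hL, hM, .rel _ _ ⟨hL, hr.isPath hL, hr⟩⟩
    · intro M hM e
      obtain ⟨L, w, hL, e', -⟩ := hp.lift_path hl'
      obtain ⟨M', hr, hM'⟩ := key _ L hL e'
      obtain rfl := hp.path_inj hM (hr.isPath hL) (e.trans hM'.symm)
      obtain rfl := hM.unique (hr.isPath hL)
      exact ⟨L, hL, e', .symm (.rel _ _ ⟨hL, hM, hr⟩)⟩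
  intro w L hL e
  cases h with
  | backtrack l m d =>
    obtain ⟨L1, L2, rfl, rfl, e2⟩ := List.map_eq_append_iff.1 e
    obtain ⟨D, L3, rfl, rfl, e3⟩ := List.map_eq_cons_iff.1 e2
    obtain ⟨D', L4, rfl, e4, rfl⟩ := List.map_eq_cons_iff.1 e3
    obtain ⟨z, -, -, h2, -⟩ := isPath_append.1 hL
    have : D' = K.rev D := hp.dart_injOn _ h2 rfl (by rw [e4, p.rev_dart])
    subst this
    exact ⟨L1 ++ L4, .backtrack _ _ _, by simp⟩
  | face l m f =>
    obtain ⟨L1, L2, rfl, rfl, e2⟩ := List.map_eq_append_iff.1 e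
    obtain ⟨D, L3, rfl, e5, e3⟩ := List.map_eq_cons_iff.1 e2
    obtain ⟨D', L4, rfl, e6, e4⟩ := List.map_eq_cons_iff.1 e3
    obtain ⟨D'', L5, rfl, e7, rfl⟩ := List.map_eq_cons_iff.1 e4
    obtain ⟨z, -, -, h2, h3, -⟩ := isPath_append.1 hL
    obtain ⟨g, ⟨rfl, rfl⟩, -⟩ := hp.lift_flag D f e5.symm
    have h4 : D' = K.edge (K.rot g) := hp.dart_injOn _ h2 (K.src_edge_rot g)
      (by rw [e6, p.rot_flag, p.edge_flag])
    subst h4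
    have h5 : D'' = K.edge (K.rot (K.rot g)) := hp.dart_injOn _ h3 (K.src_edge_rot _)
      (by rw [e7, p.rot_flag, p.rot_flag, p.edge_flag])
    subst h5
    exact ⟨L1 ++ L5, .face _ _ _, by simp⟩

/-- Homotopies lift to a covering. -/
theorem lift_homotopic {x z : K.Vert} {y' : K'.Vert} {l' m' : List K'.Dart}
    (h : K'.Homotopic (p.vert x) y' l' m') :
    (∀ L, K.IsPath x L z → L.map p.dart = l' →
      ∃ M, K.IsPath x M z ∧ M.map p.dart = m' ∧ K.Homotopic x z L M) ∧
    (∀ M, K.IsPath x M z → M.map p.dart = m' →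
      ∃ L, K.IsPath x L z ∧ L.map p.dart = l' ∧ K.Homotopic x z M L) := by
  induction h with
  | rel l m h => exact hp.lift_reduction h.1 h.2.2
  | refl l => exact ⟨fun L hL e => ⟨L, hL, e, .refl _ _ _⟩, fun L hL e => ⟨L, hL, e, .refl _ _ _⟩⟩
  | symm l m _ ih => exact ih.symm
  | trans l m n _ _ ih ih' =>
    constructor
    · intro L hL e
      obtain ⟨M, hM, eM, hLM⟩ := ih.1 L hL e
      obtain ⟨N, hN, eN, hMN⟩ := ih'.1 M hM eM
      exact ⟨N, hN, eN, hLM.trans hMN⟩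
    · intro L hL e
      obtain ⟨M, hM, eM, hLM⟩ := ih'.2 L hL e
      obtain ⟨N, hN, eN, hMN⟩ := ih.2 M hM eM
      exact ⟨N, hN, eN, hLM.trans hMN⟩

/-! ### Links, roots and parity under coverings -/

/-- A covering restricts to isomorphisms of links. -/
theorem isComponentIso (x : K.Vert) :
    SimpleGraph.IsComponentIso K.linkGraph K'.linkGraph {d | K.src d = x} p.dart where
  injOn := hp.dart_injOn x
  mem_of_adj := by
    rintro _ _ ha ⟨-, f, rfl, rfl⟩
    exact (K.src_edge_rot f).trans ha
  map_adj := by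
    rintro _ _ ha ⟨hne, f, rfl, rfl⟩
    refine ⟨fun h => hne (hp.dart_injOn x ha ((K.src_edge_rot f).trans ha) h), p.flag f, ?_, ?_⟩
    · rw [p.edge_flag, p.rev_dart]
    · rw [p.rot_flag, p.edge_flag]
  lift_adj := by
    rintro a _ ha ⟨hne, f', h1, rfl⟩
    obtain ⟨f, ⟨h2, rfl⟩, -⟩ := hp.lift_flag (K.rev a) f' (by rw [← p.rev_dart, ← h1, K'.rev_rev])
    have h3 : p.dart (K.edge (K.rot f)) = K'.edge (K'.rot (p.flag f)) := by
      rw [p.rot_flag, p.edge_flag]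
    refine ⟨K.edge (K.rot f), ⟨?_, f, ?_, rfl⟩, h3⟩
    · rintro rfl
      exact hne h3
    · rw [h2, K.rev_rev]

theorem isRankSevenFourths (h : K'.IsRankSevenFourths) : K.IsRankSevenFourths where
  no_loop f hf := h.no_loop (p.flag f) (by rw [p.edge_flag, p.rev_dart, hf, p.rot_flag, p.edge_flag])
  no_multiple f g e1 e2 := hp.flag_inj e1 <| h.no_multiple _ _
    (by rw [p.edge_flag, e1, p.edge_flag])
    (by rw [p.rot_flag, p.edge_flag, e2, p.rot_flag, p.edge_flag])
  link_iso x := by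
    obtain ⟨e⟩ := h.link_iso (p.vert x)
    obtain ⟨e'⟩ := (hp.isComponentIso x).nonempty_iso (B := {d | K'.src d = p.vert x}) <| by
      ext d'
      constructor
      · rintro ⟨d, hd, rfl⟩
        exact (p.src_dart d).trans (congrArg p.vert hd)
      · intro hd'
        obtain ⟨d, ⟨h1, h2⟩, -⟩ := hp.lift_dart x d' hd'
        exact ⟨d, h1, h2⟩
    exact ⟨e'.trans e⟩

omit hp in
theorem flag_rot_iterate (p : Hom K K') (f : K.Flag) (i : ℕ) :
    p.flag (K.rot^[i] f) = K'.rot^[i] (p.flag f) := by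
  induction i with
  | zero => rfl
  | succ i ih => rw [Function.iterate_succ_apply', Function.iterate_succ_apply', ← ih, p.rot_flag]

end IsCovering

end Hom

theorem edge_rot_rot_rot (f : K.Flag) : K.edge (K.rot (K.rot (K.rot f))) = K.edge f := by
  rw [K.rot_rot_rot]

/-- Consecutive edges of a side of a 2-triangle have the same origin, and bound the corners of three
faces. -/
theorem TwoTriangle.side_corner {f : K.Flag} (T : K.TwoTriangle f) (i : Fin 3) :
    (∃ g, K.rev (K.edge g) = T.side i 1 ∧ K.edge (K.rot g) = T.side i 0) ∧
    (∃ g, K.rev (K.edge g) = T.side i 1 ∧ K.edge (K.rot g) = T.side i 2) ∧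
    (∃ g, K.rev (K.edge g) = T.side i 3 ∧ K.edge (K.rot g) = T.side i 2) := by
  refine ⟨⟨T.outer i, ?_, rfl⟩, ⟨K.rot^[i] f, rfl, ?_⟩, ⟨K.rot (K.rot (T.outer (i + 1))), rfl, ?_⟩⟩
  · rw [T.edge_outer]
    rfl
  · rw [← Function.iterate_succ_apply' K.rot]
    rfl
  · rw [K.rot_rot_rot, T.edge_outer]
    fin_cases i
    · rfl
    · rfl
    · exact (edge_rot_rot_rot f).symm

theorem TwoTriangle.src_side {f : K.Flag} (T : K.TwoTriangle f) (i : Fin 3) (j : Fin 4) :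
    K.src (T.side i j) = K.src (T.side i 1) := by
  obtain ⟨⟨g, h1, h2⟩, ⟨g', h3, h4⟩, ⟨g'', h5, h6⟩⟩ := T.side_corner i
  have e0 : K.src (T.side i 0) = K.src (T.side i 1) := by rw [← h1, ← h2, K.src_edge_rot]
  have e2 : K.src (T.side i 2) = K.src (T.side i 1) := by rw [← h3, ← h4, K.src_edge_rot]
  have e3 : K.src (T.side i 3) = K.src (T.side i 2) := by rw [← h5, ← h6, K.src_edge_rot]
  fin_cases j
  exacts [e0, rfl, e2, e3.trans e2]

namespace Hom

variable {p : Hom K K'}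

theorem IsCovering.numRankTwo_eq (hp : p.IsCovering) {f : K.Flag} (T : K.TwoTriangle f)
    (T' : K'.TwoTriangle (p.flag f)) (h : ∀ i, p.flag (T.outer i) = T'.outer i) :
    T'.numRankTwo = T.numRankTwo := by
  have hs : ∀ i, T'.side i = p.dart ∘ T.side i := by
    intro i
    ext j
    simp only [TwoTriangle.side, ← h, ← IsCovering.flag_rot_iterate, p.rot_flag, p.edge_flag,
      p.rev_dart]
    fin_cases j <;> rfl
  unfold TwoTriangle.numRankTwo
  congr 1
  ext i
  have hi : ∀ j, T.side i j ∈ {d | K.src d = K.src (T.side i 1)} := T.src_side i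
  have hc := hp.isComponentIso (K.src (T.side i 1))
  simp only [Set.mem_ofPred_eq, hs, hc.isRoot_comp hi, hc.rootRank_comp hi]

/-- Coverings preserve the parity of faces. -/
theorem IsCovering.isEvenFace_iff (hp : p.IsCovering) (f : K.Flag) :
    K'.IsEvenFace (p.flag f) ↔ K.IsEvenFace f := by
  constructor
  · intro h T
    let T' : K'.TwoTriangle (p.flag f) :=
      { outer := fun i => p.flag (T.outer i)
        edge_outer := fun i => by
          rw [← IsCovering.flag_rot_iterate, p.edge_flag, p.edge_flag, T.edge_outer]
        outer_ne := fun i hi => T.outer_ne i <| hp.flag_inj (T.edge_outer i) <| by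
          rw [hi, IsCovering.flag_rot_iterate] }
    rw [← hp.numRankTwo_eq T T' fun _ => rfl]
    exact h T'
  · intro h T'
    have : ∀ i : Fin 3, ∃ g, K.edge g = K.edge (K.rot^[i] f) ∧ p.flag g = T'.outer i := fun i => by
      refine (hp.lift_flag (K.edge (K.rot^[i] f)) (T'.outer i) ?_).exists
      rw [T'.edge_outer, ← IsCovering.flag_rot_iterate, p.edge_flag]
    choose g hg hg' using this
    let T : K.TwoTriangle f :=
      { outer := g
        edge_outer := hg
        outer_ne := fun i hi => T'.outer_ne i <| by
          rw [← hg', hi, IsCovering.flag_rot_iterate] }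
    rw [hp.numRankTwo_eq T T' hg']
    exact h T

end Hom

end TriangleComplex

namespace TriangleComplex

/-! ### Existence of universal covers -/

section PathCover

variable (K : TriangleComplex) (x₀ : K.Vert)

/-- Edge paths that start at `x₀`, together with their end points. -/
abbrev BasedPath : Type := {p : K.Vert × List K.Dart // K.IsPath x₀ p.2 p.1}

/-- Homotopy classes of edge paths that start at `x₀`. -/
def PathClass : Type :=
  Quot fun p q : K.BasedPath x₀ => p.1.1 = q.1.1 ∧ K.Homotopic x₀ p.1.1 p.1.2 q.1.2

namespace PathClass

variable {K x₀}

/-- The class of an edge path. -/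
def ofPath {y : K.Vert} {l : List K.Dart} (h : K.IsPath x₀ l y) : K.PathClass x₀ :=
  Quot.mk _ ⟨(y, l), h⟩

theorem exists_ofPath (V : K.PathClass x₀) : ∃ y l, ∃ h : K.IsPath x₀ l y, V = ofPath h := by
  obtain ⟨⟨⟨y, l⟩, h⟩⟩ := V
  exact ⟨y, l, h, rfl⟩

theorem ofPath_eq_ofPath {y : K.Vert} {l m : List K.Dart} (h : K.IsPath x₀ l y) (h' : K.IsPath x₀ m y) :
    ofPath h = ofPath h' ↔ K.Homotopic x₀ y l m := by
  refine ⟨fun e => ?_, fun e => Quot.sound ⟨rfl, e⟩⟩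
  have := (Quot.eqvGen_exact e)
  have key : ∀ p q : K.BasedPath x₀, Relation.EqvGen (fun p q : K.BasedPath x₀ =>
      p.1.1 = q.1.1 ∧ K.Homotopic x₀ p.1.1 p.1.2 q.1.2) p q →
      p.1.1 = q.1.1 ∧ K.Homotopic x₀ p.1.1 p.1.2 q.1.2 := by
    intro p q hpq
    induction hpq with
    | rel p q h => exact h
    | refl p => exact ⟨rfl, .refl _ _ _⟩
    | symm p q _ ih => exact ⟨ih.1.symm, ih.1 ▸ ih.2.symm⟩
    | trans p q r _ _ ih ih' => exact ⟨ih.1.trans ih'.1, ih.2.trans (ih.1 ▸ ih'.2)⟩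
  exact (key _ _ this).2

/-- The end point of a class of paths. -/
def tgt : K.PathClass x₀ → K.Vert :=
  Quot.lift (fun p => p.1.1) fun _ _ h => h.1

open Classical in
/-- The class of the paths continued by the oriented edge `d`; the junk value, if `d` does not start at
their end point, is the class itself. -/
noncomputable def ext (V : K.PathClass x₀) (d : K.Dart) : K.PathClass x₀ :=
  Quot.lift
    (fun p : K.BasedPath x₀ =>
      if h : K.src d = p.1.1 then
        ofPath (p.2.append (isPath_singleton.2 ⟨h, rfl⟩))
      else Quot.mk _ p)
    (by
      rintro ⟨⟨y, l⟩, hl⟩ ⟨⟨z, m⟩, hm⟩ ⟨h1, h2⟩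
      obtain rfl : y = z := h1
      by_cases h : K.src d = y
      · refine (dif_pos h).trans (Eq.trans ?_ (dif_pos h).symm)
        exact (ofPath_eq_ofPath _ _).2 <| h2.append (j := []) rfl (isPath_singleton.2 ⟨h, rfl⟩)
      · refine (dif_neg h).trans (Eq.trans ?_ (dif_neg h).symm)
        exact Quot.sound ⟨rfl, h2⟩) V

@[simp]
theorem tgt_ofPath {y : K.Vert} {l : List K.Dart} (h : K.IsPath x₀ l y) : (ofPath h).tgt = y := rfl

theorem ext_ofPath {y : K.Vert} {l : List K.Dart} (h : K.IsPath x₀ l y) {d : K.Dart}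
    (hd : K.src d = y) :
    (ofPath h).ext d = ofPath (h.append (isPath_singleton.2 ⟨hd, rfl⟩)) :=
  dif_pos hd

@[simp]
theorem tgt_ext {V : K.PathClass x₀} {d : K.Dart} (hd : K.src d = V.tgt) :
    (V.ext d).tgt = K.src (K.rev d) := by
  obtain ⟨y, l, h, rfl⟩ := V.exists_ofPath
  rw [ext_ofPath h hd, tgt_ofPath]

theorem ext_ext_rev {V : K.PathClass x₀} {d : K.Dart} (hd : K.src d = V.tgt) :
    (V.ext d).ext (K.rev d) = V := by
  obtain ⟨y, l, h, rfl⟩ := V.exists_ofPath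
  obtain rfl : K.src d = y := hd
  have e : K.src (K.rev (K.rev d)) = K.src d := by rw [K.rev_rev]
  rw [ext_ofPath h rfl, ext_ofPath _ rfl]
  have hr : K.Reduction (l ++ [d] ++ [K.rev d]) l := by
    simpa using Reduction.backtrack (K := K) l [] d
  have hp : K.IsPath x₀ (l ++ [d] ++ [K.rev d]) (K.src d) :=
    (h.append (isPath_singleton.2 ⟨rfl, rfl⟩)).append (isPath_singleton.2 ⟨rfl, e⟩)
  have : ofPath hp = ofPath h := (ofPath_eq_ofPath _ _).2 (.rel _ _ ⟨hp, h, hr⟩)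
  rw [← this]
  congr 1

theorem ext_face {V : K.PathClass x₀} {f : K.Flag} (hf : K.src (K.edge f) = V.tgt) :
    ((V.ext (K.edge f)).ext (K.edge (K.rot f))).ext (K.edge (K.rot (K.rot f))) = V := by
  obtain ⟨y, l, h, rfl⟩ := V.exists_ofPath
  obtain rfl : K.src (K.edge f) = y := hf
  have e : K.src (K.rev (K.edge (K.rot (K.rot f)))) = K.src (K.edge f) := by
    rw [← K.src_edge_rot, K.rot_rot_rot]
  rw [ext_ofPath h rfl, ext_ofPath _ (K.src_edge_rot _), ext_ofPath _ (K.src_edge_rot _)]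
  have hr : K.Reduction (l ++ [K.edge f] ++ [K.edge (K.rot f)] ++ [K.edge (K.rot (K.rot f))]) l := by
    simpa using Reduction.face (K := K) l [] f
  have hp : K.IsPath x₀ (l ++ [K.edge f] ++ [K.edge (K.rot f)] ++ [K.edge (K.rot (K.rot f))])
      (K.src (K.edge f)) :=
    ((h.append (isPath_singleton.2 ⟨rfl, rfl⟩)).append
      (isPath_singleton.2 ⟨K.src_edge_rot _, rfl⟩)).append (isPath_singleton.2 ⟨K.src_edge_rot _, e⟩)
  have : ofPath hp = ofPath h := (ofPath_eq_ofPath _ _).2 (.rel _ _ ⟨hp, h, hr⟩)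
  rw [← this]
  congr 1

end PathClass

open PathClass

/-- The complex of homotopy classes of paths that start at `x₀`. An edge or a flag of it consists of
its origin and of its image in `K`. -/
noncomputable def pathCover : TriangleComplex where
  Vert := K.PathClass x₀
  Dart := {D : K.PathClass x₀ × K.Dart // K.src D.2 = D.1.tgt}
  Flag := {F : K.PathClass x₀ × K.Flag // K.src (K.edge F.2) = F.1.tgt}
  src D := D.1.1
  rev D := ⟨(D.1.1.ext D.1.2, K.rev D.1.2), (tgt_ext D.2).symm⟩
  rev_rev := by
    rintro ⟨⟨V, d⟩, h⟩
    exact Subtype.ext (Prod.ext (ext_ext_rev h) (K.rev_rev d))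
  rev_ne D h := K.rev_ne D.1.2 (congrArg (fun D => D.1.2) h)
  edge F := ⟨(F.1.1, K.edge F.1.2), F.2⟩
  rot F := ⟨(F.1.1.ext (K.edge F.1.2), K.rot F.1.2), by rw [K.src_edge_rot, tgt_ext F.2]⟩
  flip F := ⟨(F.1.1.ext (K.edge F.1.2), K.flip F.1.2), by rw [K.edge_flip, tgt_ext F.2]⟩
  rot_rot_rot := by
    rintro ⟨⟨V, f⟩, h⟩
    exact Subtype.ext (Prod.ext (ext_face h) (K.rot_rot_rot f))
  rot_ne F h := K.rot_ne F.1.2 (congrArg (fun F => F.1.2) h)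
  flip_flip := by
    rintro ⟨⟨V, f⟩, h⟩
    refine Subtype.ext (Prod.ext ?_ (K.flip_flip f))
    simp only [K.edge_flip]
    exact ext_ext_rev h
  flip_rot := by
    rintro ⟨⟨V, f⟩, h⟩
    refine Subtype.ext (Prod.ext ?_ (K.flip_rot f))
    have e : K.edge (K.rot (K.flip f)) = K.rev (K.edge (K.rot (K.rot f))) := by
      rw [← K.edge_flip, K.flip_rot, K.flip_rot, K.rot_rot_rot]
    simp only [K.edge_flip, e]
    have h1 : (V.ext (K.edge f)).tgt = K.src (K.edge (K.rot f)) := by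
      rw [tgt_ext h, K.src_edge_rot]
    have h2 : ((V.ext (K.edge f)).ext (K.edge (K.rot f))).tgt = K.src (K.edge (K.rot (K.rot f))) := by
      rw [tgt_ext h1.symm, K.src_edge_rot]
    rw [ext_ext_rev h]
    conv_rhs => rw [← ext_face h]
    rw [ext_ext_rev h2.symm]
  edge_flip F := Subtype.ext (Prod.ext rfl (K.edge_flip F.1.2))
  src_edge_rot F := rfl

/-- The projection of a class of paths to its end point. -/
noncomputable def pathCoverProj : Hom (K.pathCover x₀) K where
  vert := PathClass.tgt
  dart D := D.1.2
  flag F := F.1.2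
  src_dart D := D.2
  rev_dart _ := rfl
  edge_flag _ := rfl
  rot_flag _ := rfl
  flip_flag _ := rfl

variable {K x₀}

theorem pathCoverProj_isCovering (hK : ∀ y, ∃ l, K.IsPath x₀ l y) :
    (K.pathCoverProj x₀).IsCovering where
  surjective y := by
    obtain ⟨l, h⟩ := hK y
    exact ⟨ofPath h, rfl⟩
  lift_dart V d h := by
    refine ⟨⟨(V, d), h⟩, ⟨rfl, rfl⟩, ?_⟩
    rintro D ⟨rfl, rfl⟩
    rfl
  lift_flag D f h := by
    refine ⟨⟨(D.1.1, f), ?_⟩, ⟨Subtype.ext (Prod.ext rfl h), rfl⟩, ?_⟩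
    · rw [h]
      exact D.2
    · rintro F ⟨rfl, rfl⟩
      rfl

/-- Continuing the class `V` along a path leads to the end point of the lifted path. -/
theorem eq_of_isPath_pathCover {V W : K.PathClass x₀} {L : List (K.pathCover x₀).Dart}
    (hL : (K.pathCover x₀).IsPath V L W) {y z : K.Vert} {l : List K.Dart}
    (hl : K.IsPath x₀ l y) (hV : V = ofPath hl)
    (hm : K.IsPath y (L.map (K.pathCoverProj x₀).dart) z) : W = ofPath (hl.append hm) := by
  induction L generalizing V y l with
  | nil =>
    obtain rfl : y = z := hm
    obtain rfl : V = W := hL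
    rw [hV]
    congr 1
    simp
  | cons D L ih =>
    obtain ⟨hD, hL⟩ := hL
    obtain rfl : D.1.1 = V := hD
    have h1 : K.src D.1.2 = y := hm.1
    have := ih hL (hl.append (isPath_singleton.2 ⟨h1, rfl⟩))
      (by
        rw [← ext_ofPath hl h1, ← hV]
        rfl) hm.2
    rw [this]
    congr 1
    simp [pathCoverProj]

theorem pathCover_isSimplyConnected (hK : ∀ y, ∃ l, K.IsPath x₀ l y) :
    (K.pathCover x₀).IsSimplyConnected := by
  have hp := pathCoverProj_isCovering hK
  set V₀ : K.PathClass x₀ := ofPath (l := []) rfl with hV₀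
  have hlift : ∀ {y l} (h : K.IsPath x₀ l y), ∃ L, (K.pathCover x₀).IsPath V₀ L (ofPath h) ∧
      L.map (K.pathCoverProj x₀).dart = l := by
    intro y l h
    obtain ⟨L, W, hL, rfl, -⟩ := hp.lift_path (x := V₀) h
    obtain rfl := eq_of_isPath_pathCover hL (y := x₀) (l := []) rfl hV₀ h
    exact ⟨L, hL, rfl⟩
  have hconn : ∀ V, ∃ L, (K.pathCover x₀).IsPath V₀ L V := by
    intro V
    obtain ⟨y, l, h, rfl⟩ := V.exists_ofPath
    obtain ⟨L, hL, -⟩ := hlift h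
    exact ⟨L, hL⟩
  refine ⟨⟨V₀⟩, fun V W => ?_, fun V L hL => ?_⟩
  · obtain ⟨L, hL⟩ := hconn V
    obtain ⟨M, hM⟩ := hconn W
    exact ⟨_, hL.reverse.append hM⟩
  · obtain ⟨y, l, h, rfl⟩ := V.exists_ofPath
    obtain ⟨L₀, hL₀, rfl⟩ := hlift h
    have hm := (K.pathCoverProj x₀).isPath_map hL
    have h1 := (ofPath_eq_ofPath _ _).1 (eq_of_isPath_pathCover hL h rfl hm)
    obtain ⟨M, hM, eM, hLM⟩ := (hp.lift_homotopic (x := V₀) h1).1 L₀ hL₀ rfl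
    obtain rfl := hp.path_inj hM (hL₀.append hL) (by simpa using eM)
    -- Now `L₀` and `L₀ ++ L` are homotopic, and `L₀` can be cancelled.
    have h2 := hLM.append (k := []) hL₀.reverse rfl
    have h3 := (homotopic_reversePath_append hL₀).append (j := []) (k := L) rfl hL
    have h4 := homotopic_reversePath_append hL₀
    simp only [List.append_nil, List.nil_append, List.append_assoc] at h2 h3
    exact h3.symm.trans (h2.symm.trans h4)

/-- A non-empty connected complex has a universal cover. -/
theorem nonempty_universalCover (hK : ∀ y, ∃ l, K.IsPath x₀ l y) : Nonempty K.UniversalCover :=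
  ⟨⟨K.pathCover x₀, K.pathCoverProj x₀, pathCoverProj_isCovering hK,
    pathCover_isSimplyConnected hK⟩⟩

end PathCover

end TriangleComplex

/-! ### Roots of rank 2 in the Möbius–Kantor graph -/

instance : DecidableRel moebiusKantor.Adj := fun i j =>
  decidable_of_iff _ (SimpleGraph.fromRel_adj _ i j).symm

/-- The neighbours of a vertex of the Möbius–Kantor graph. -/
def mkNeighbor (i : ZMod 16) : Fin 3 → ZMod 16 :=
  ![i + 1, i - 1, if Even i.val then i + 5 else i - 5]

theorem moebiusKantor_adj_iff (i j : ZMod 16) :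
    moebiusKantor.Adj i j ↔ ∃ s, j = mkNeighbor i s := by
  revert i j
  decide +kernel

theorem mkNeighbor_injective (i : ZMod 16) : (mkNeighbor i).Injective := by
  revert i
  decide +kernel

theorem ncard_neighborSet_moebiusKantor (i : ZMod 16) :
    (moebiusKantor.neighborSet i).ncard = 3 := by
  have : moebiusKantor.neighborSet i = Set.range (mkNeighbor i) := by
    ext j
    simp [moebiusKantor_adj_iff, eq_comm]
  rw [this, ← Set.image_univ, Set.InjOn.ncard_image (mkNeighbor_injective i).injOn, Set.ncard_univ]
  simp

/-- The pairs of vertices of the Möbius–Kantor graph which are the end points of three paths of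
length 3. -/
def mkTriple (i j : ZMod 16) : Bool :=
  if Even i.val then j = i + 3 || j = i + 11 else i = j + 3 || i = j + 11

/-- The end point of the path of length 3 from `i` which passes in turn to the neighbours numbered
`s.1`, `s.2.1`, `s.2.2`. -/
def mkEnd (i : ZMod 16) (s : Fin 3 × Fin 3 × Fin 3) : ZMod 16 :=
  mkNeighbor (mkNeighbor (mkNeighbor i s.1) s.2.1) s.2.2

theorem card_mkEnd_eq_three_iff (i j : ZMod 16) :
    (Finset.univ.filter fun s => mkEnd i s = j).card = 3 ↔ mkTriple i j = true := by
  revert i j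
  decide +kernel

theorem far_of_mkTriple (i j : ZMod 16) : mkTriple i j = true →
    i ≠ j ∧ (∀ s, mkNeighbor i s ≠ j) ∧ ∀ s t, mkNeighbor (mkNeighbor i s) t ≠ j := by
  revert i j
  decide +kernel

theorem isRoot_moebiusKantor_of_mkTriple {α : Fin 4 → ZMod 16}
    (h1 : moebiusKantor.Adj (α 0) (α 1)) (h2 : moebiusKantor.Adj (α 1) (α 2))
    (h3 : moebiusKantor.Adj (α 2) (α 3)) (h : mkTriple (α 0) (α 3) = true) :
    moebiusKantor.IsRoot α := by
  obtain ⟨n0, n1, n2⟩ := far_of_mkTriple _ _ h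
  refine (SimpleGraph.isRoot_iff α).2 ⟨h1, h2, h3, n0, ?_, ?_⟩
  · rw [moebiusKantor_adj_iff]
    rintro ⟨s, hs⟩
    exact n1 s hs.symm
  · intro c hc hc'
    rw [moebiusKantor_adj_iff] at hc hc'
    obtain ⟨s, rfl⟩ := hc
    obtain ⟨t, ht⟩ := hc'
    exact n2 s t ht.symm

/-- A root of the Möbius–Kantor graph is one of the paths of length 3 with the same end points. -/
theorem ncard_add_one_eq_card_mkEnd {α : Fin 4 → ZMod 16} (hα : moebiusKantor.IsRoot α) :
    Set.ncard {β | moebiusKantor.IsRoot β ∧ β ≠ α ∧ β 0 = α 0 ∧ β 3 = α 3} + 1 =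
      (Finset.univ.filter fun s => mkEnd (α 0) s = α 3).card := by
  let path (s : Fin 3 × Fin 3 × Fin 3) : Fin 4 → ZMod 16 :=
    ![α 0, mkNeighbor (α 0) s.1, mkNeighbor (mkNeighbor (α 0) s.1) s.2.1, mkEnd (α 0) s]
  have hinj : path.Injective := by
    intro s t h
    have h1 := mkNeighbor_injective _ (congrFun h 1)
    have h2 := congrFun h 2
    have h3 := congrFun h 3
    simp only [path, mkEnd, Matrix.cons_val, h1] at h2 h3
    have h2 := mkNeighbor_injective _ h2
    rw [h2] at h3
    exact Prod.ext h1 (Prod.ext h2 (mkNeighbor_injective _ h3))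
  have himage : path '' {s | mkEnd (α 0) s = α 3} =
      insert α {β | moebiusKantor.IsRoot β ∧ β ≠ α ∧ β 0 = α 0 ∧ β 3 = α 3} := by
    ext β
    constructor
    · rintro ⟨s, hs, rfl⟩
      refine or_iff_not_imp_left.2 fun hne => ⟨⟨?_, ?_, ?_, ?_⟩, hne, rfl, hs⟩
      · exact (moebiusKantor_adj_iff _ _).2 ⟨_, rfl⟩
      · exact (moebiusKantor_adj_iff _ _).2 ⟨_, rfl⟩
      · exact (moebiusKantor_adj_iff _ _).2 ⟨_, rfl⟩
      · exact (congrArg (moebiusKantor.dist (α 0)) hs).trans hα.2.2.2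
    · intro hβ
      have hβ : moebiusKantor.IsRoot β ∧ β 0 = α 0 ∧ β 3 = α 3 := by
        obtain rfl | h := hβ
        · exact ⟨hα, rfl, rfl⟩
        · exact ⟨h.1, h.2.2⟩
      obtain ⟨⟨h1, h2, h3, -⟩, e0, e3⟩ := hβ
      rw [moebiusKantor_adj_iff] at h1 h2 h3
      obtain ⟨s, hs⟩ := h1
      obtain ⟨t, ht⟩ := h2
      obtain ⟨u, hu⟩ := h3
      rw [e0] at hs
      rw [hs] at ht
      rw [ht] at hu
      refine ⟨(s, t, u), hu.symm.trans e3, ?_⟩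
      ext i
      fin_cases i
      exacts [e0.symm, hs.symm, ht.symm, hu.symm]
  have hfin : {β | moebiusKantor.IsRoot β ∧ β ≠ α ∧ β 0 = α 0 ∧ β 3 = α 3}.Finite :=
    ((Set.toFinite _).image path).subset (himage ▸ Set.subset_insert _ _)
  rw [← Set.ncard_insert_of_notMem (fun h => h.2.1 rfl) hfin, ← himage,
    Set.InjOn.ncard_image hinj.injOn, ← Set.ncard_coe_finset]
  simp

/-- Whether a path of length 3 in the Möbius–Kantor graph is a root of rank 2 depends only on its end
points. -/
theorem isRoot_moebiusKantor_iff (α : Fin 4 → ZMod 16) :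
    moebiusKantor.IsRoot α ∧ moebiusKantor.rootRank α = 2 ↔
      moebiusKantor.Adj (α 0) (α 1) ∧ moebiusKantor.Adj (α 1) (α 2) ∧
        moebiusKantor.Adj (α 2) (α 3) ∧ mkTriple (α 0) (α 3) = true := by
  have key : moebiusKantor.IsRoot α →
      (moebiusKantor.rootRank α = 2 ↔ mkTriple (α 0) (α 3) = true) := by
    intro hα
    rw [← card_mkEnd_eq_three_iff, ← ncard_add_one_eq_card_mkEnd hα, SimpleGraph.rootRank,
      ncard_neighborSet_moebiusKantor]
    generalize Set.ncard _ = k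
    constructor
    · intro h
      have : (k : ℚ) = 2 := by
        push_cast at h
        linarith
      have : k = 2 := by exact_mod_cast this
      omega
    · intro h
      obtain rfl : k = 2 := by omega
      norm_num
  constructor
  · rintro ⟨h, h'⟩
    exact ⟨h.1, h.2.1, h.2.2.1, (key h).1 h'⟩
  · rintro ⟨h1, h2, h3, h⟩
    have := isRoot_moebiusKantor_of_mkTriple h1 h2 h3 h
    exact ⟨this, (key this).2 h⟩

namespace TriangleComplex

variable {K K' : TriangleComplex}

/-! ### The radius of evenness -/

theorem IsEvenBall.le_evennessRadius {x : K.Vert} {r : ℕ} (h : K.IsEvenBall x r) :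
    (r : ℕ∞) ≤ K.evennessRadius :=
  le_iSup₂ (f := fun (r : ℕ) (_ : r ∈ {r : ℕ | ∃ x, K.IsEvenBall x r}) => (r : ℕ∞)) r ⟨x, h⟩

theorem evennessRadius_le {D : ℕ} (h : ∀ x r, K.IsEvenBall x r → r ≤ D) :
    K.evennessRadius ≤ D :=
  iSup₂_le fun r ⟨x, hr⟩ => Nat.cast_le.2 (h x r hr)

theorem Hom.map_mem_ball (p : Hom K K') {x y : K.Vert} {r : ℕ} (h : y ∈ K.ball x r) :
    p.vert y ∈ K'.ball (p.vert x) r := by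
  obtain ⟨l, hl, hr⟩ := h
  exact ⟨_, p.isPath_map hl, by simpa using hr⟩

theorem IsIsomorphic.evennessRadius_eq (h : K.IsIsomorphic K') :
    K.evennessRadius = K'.evennessRadius := by
  obtain ⟨p, hv, hd, hf⟩ := h
  have hp := p.isCovering_of_bijective hv hd hf
  have hball : ∀ x y r, p.vert y ∈ K'.ball (p.vert x) r ↔ y ∈ K.ball x r := by
    refine fun x y r => ⟨?_, p.map_mem_ball⟩
    rintro ⟨l', hl', hr⟩
    obtain ⟨l, z, hl, rfl, hz⟩ := hp.lift_path hl'
    obtain rfl := hv.1 hz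
    exact ⟨l, hl, by simpa using hr⟩
  have hsrc : ∀ f, K'.src (K'.edge (p.flag f)) = p.vert (K.src (K.edge f)) := by
    intro f
    rw [p.edge_flag, p.src_dart]
  have heven : ∀ x r, K'.IsEvenBall (p.vert x) r ↔ K.IsEvenBall x r := by
    intro x r
    unfold IsEvenBall
    rw [hf.2.forall]
    simp only [p.rot_flag, hsrc, hball, hp.isEvenFace_iff]
  have : {r : ℕ | ∃ x, K.IsEvenBall x r} = {r : ℕ | ∃ x, K'.IsEvenBall x r} := by
    ext r
    simp only [Set.mem_ofPred_eq, hv.2.exists, heven]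
  unfold evennessRadius
  rw [this]

/-- If `K` is finite and connected and has an odd face, then the radii of evenness of its coverings
are bounded. -/
theorem exists_evennessRadius_le [Finite K.Vert] (hK : ∀ x y, ∃ l, K.IsPath x l y) {f₀ : K.Flag}
    (hf₀ : ¬ K.IsEvenFace f₀) :
    ∃ D : ℕ, ∀ (X : TriangleComplex) (p : Hom X K), p.IsCovering → X.evennessRadius ≤ D := by
  choose l hl using fun x => hK x (K.src (K.edge f₀))
  obtain ⟨D, hD⟩ := (Set.finite_range fun x => (l x).length).bddAbove
  refine ⟨D + 2, fun X p hp => evennessRadius_le fun x r hx => ?_⟩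
  by_contra hr
  -- The path from the image of `x` to the odd face lifts, and then the odd face lifts.
  obtain ⟨L, y, hL, eL, hy⟩ := hp.lift_path (hl (p.vert x))
  have hlen : L.length ≤ D := by
    rw [← L.length_map (f := p.dart), eL]
    exact hD ⟨_, rfl⟩
  obtain ⟨d, ⟨rfl, hd⟩, -⟩ := hp.lift_dart y (K.edge f₀) hy.symm
  obtain ⟨f, ⟨rfl, rfl⟩, -⟩ := hp.lift_flag d f₀ hd.symm
  refine hf₀ ((hp.isEvenFace_iff f).2 (hx f ⟨L, hL, by omega⟩
    ⟨L ++ [X.edge f], hL.append (isPath_singleton.2 ⟨rfl, (X.src_edge_rot f).symm⟩), ?_⟩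
    ⟨L ++ [X.edge f] ++ [X.edge (X.rot f)],
      (hL.append (isPath_singleton.2 ⟨rfl, rfl⟩)).append
        (isPath_singleton.2 ⟨X.src_edge_rot f, (X.src_edge_rot _).symm⟩), ?_⟩))
  · simp
    omega
  · simp
    omega

end TriangleComplex

/-! ### Coordinates on the glued complexes -/

/-- Representatives of the edge labels of a cyclic composition of copies of `X₀₀` and `Y₀₀`: every
collar edge `x, y, z, x', y', z'` is a core edge of the term before or after it. -/
inductive EdgeLabel
  | a | b | c | d | e1 | e2 | e3 | e4
  deriving DecidableEq

instance : Fintype EdgeLabel :=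
  ⟨{.a, .b, .c, .d, .e1, .e2, .e3, .e4}, by intro l; cases l <;> decide⟩

/-- The eight triangles of `X₀₀` (for `true`) or `Y₀₀` (for `false`) with a core edge, up to the
numbering of the collars: the last two edges of the first three triangles belong to the right collar,
the other edges to the core or to the left collar. -/
def coreLabel : Bool → Fin 8 → Fin 3 → EdgeLabel
  | true => ![![.e2, .a, .d], ![.e4, .c, .d], ![.e3, .c, .b], ![.e4, .d, .a], ![.e3, .b, .a],
      ![.e2, .b, .c], ![.e1, .e1, .e2], ![.e1, .e3, .e4]]
  | false => ![![.e4, .a, .d], ![.e2, .c, .d], ![.e1, .c, .b], ![.e1, .d, .a], ![.e3, .b, .a],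
      ![.e4, .b, .c], ![.e1, .e2, .e3], ![.e2, .e4, .e3]]

/-- The position, relative to its term, of the `i`-th edge of the `k`-th triangle: `1` if it belongs to
the right collar, which is the left collar of the next term, and `0` otherwise. -/
def corePos (k : Fin 8) (i : Fin 3) : ℤ := if k < 3 ∧ i ≠ 0 then 1 else 0

/-- The faces along a term of a cyclic composition, with a distinguished side and an orientation. -/
abbrev LocalFlag : Type := (Fin 8 × Fin 3) × Bool

/-- The number of steps from the vertex at the origin of an edge to the term of this edge. The edges
`a`, `c`, and the reverses of `b`, `d`, lead from one vertex to the next one, and bear the number of the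
latter; the core edges are loops. -/
def leaves : EdgeLabel × Bool → ℤ
  | (.a, true) | (.c, true) | (.b, false) | (.d, false) => 1
  | _ => 0

namespace LocalFlag

/-- The next side. -/
def rot (h : LocalFlag) : LocalFlag :=
  ((h.1.1, if h.2 then h.1.2 + 1 else h.1.2 - 1), h.2)

/-- The same side with the reversed orientation. -/
def flip (h : LocalFlag) : LocalFlag := (h.1, !h.2)

/-- The label of the distinguished side of a local flag along a term of type `t`. -/
def label (t : Bool) (h : LocalFlag) : EdgeLabel := coreLabel t h.1.1 h.1.2

/-- The position of the distinguished side of a local flag, relative to its term. -/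
def pos (h : LocalFlag) : ℤ := corePos h.1.1 h.1.2

/-- The origin of a local flag, relative to the vertex of its term. It does not depend on the type of
this term. -/
def origin (h : LocalFlag) : ℤ := h.pos - leaves (h.label true, h.2)

theorem rot_rot_rot (h : LocalFlag) : h.rot.rot.rot = h := by
  revert h
  decide +kernel

theorem rot_ne (h : LocalFlag) : h.rot ≠ h := by
  revert h
  decide +kernel

theorem flip_flip (h : LocalFlag) : h.flip.flip = h := by
  revert h
  decide +kernel

theorem flip_rot (h : LocalFlag) : h.rot.flip = h.flip.rot.rot := by
  revert h
  decide +kernel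

theorem origin_eq (t : Bool) (h : LocalFlag) : h.origin = h.pos - leaves (h.label t, h.2) := by
  revert t h
  decide +kernel

theorem origin_rot (t : Bool) (h : LocalFlag) :
    h.rot.origin = h.pos - leaves (h.label t, !h.2) := by
  revert t h
  decide +kernel

/-- Two consecutive sides determine a flag, and at least one of them determines the number of its
term. -/
theorem eq_of_label_eq (t t' : Bool) (h h' : LocalFlag) (h1 : h.label t = h'.label t')
    (h2 : h.2 = h'.2) (h3 : h.rot.label t = h'.rot.label t') :
    (h.pos = h'.pos ∨ h.rot.pos = h'.rot.pos) ∧ (t = t' → h = h') := by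
  revert t t' h h'
  decide +kernel

end LocalFlag

/-- Explicit coordinates on the cyclic composition whose `i`-th term is `X₀₀` if `c i`, and `Y₀₀`
otherwise. The vertices correspond to the terms, and every face has a core edge in exactly one term. -/
def necklace {N : ℕ} (c : ZMod N → Bool) : TriangleComplex where
  Vert := ZMod N
  Dart := (ZMod N × EdgeLabel) × Bool
  Flag := ZMod N × LocalFlag
  src d := d.1.1 - (leaves (d.1.2, d.2) : ℤ)
  rev d := (d.1, !d.2)
  rev_rev d := by simp
  rev_ne d h := by simpa using congrArg Prod.snd h
  edge f := ((f.1 + (f.2.pos : ℤ), f.2.label (c f.1)), f.2.2)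
  rot f := (f.1, f.2.rot)
  flip f := (f.1, f.2.flip)
  rot_rot_rot f := Prod.ext rfl f.2.rot_rot_rot
  rot_ne f h := f.2.rot_ne (congrArg Prod.snd h)
  flip_flip f := Prod.ext rfl f.2.flip_flip
  flip_rot f := Prod.ext rfl f.2.flip_rot
  edge_flip f := rfl
  src_edge_rot f := by
    have h1 := f.2.origin_rot (c f.1)
    rw [f.2.rot.origin_eq (c f.1)] at h1
    simp only [add_sub_assoc, ← Int.cast_sub]
    exact congrArg (fun k : ℤ => f.1 + (k : ZMod N)) h1

/-- An isomorphism from the links of the vertices of type `t` to the Möbius–Kantor graph. -/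
def linkCoord : Bool → EdgeLabel × Bool → ZMod 16
  | true, (.a, true) => 8 | true, (.a, false) => 1 | true, (.b, true) => 4 | true, (.b, false) => 13
  | true, (.c, true) => 14 | true, (.c, false) => 5 | true, (.d, true) => 0 | true, (.d, false) => 7
  | true, (.e1, true) => 10 | true, (.e1, false) => 11 | true, (.e2, true) => 6
  | true, (.e2, false) => 9 | true, (.e3, true) => 12 | true, (.e3, false) => 3
  | true, (.e4, true) => 2 | true, (.e4, false) => 15
  | false, (.a, true) => 8 | false, (.a, false) => 1 | false, (.b, true) => 6
  | false, (.b, false) => 13 | false, (.c, true) => 14 | false, (.c, false) => 5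
  | false, (.d, true) => 0 | false, (.d, false) => 9 | false, (.e1, true) => 12
  | false, (.e1, false) => 15 | false, (.e2, true) => 10 | false, (.e2, false) => 3
  | false, (.e3, true) => 2 | false, (.e3, false) => 11 | false, (.e4, true) => 4
  | false, (.e4, false) => 7

theorem linkCoord_injective (t : Bool) : (linkCoord t).Injective := by
  revert t
  unfold Function.Injective
  decide +kernel

theorem linkCoord_surjective (t : Bool) : (linkCoord t).Surjective := by
  revert t
  unfold Function.Surjective
  decide +kernel

namespace LocalFlag

/-- The corner of a local flag of type `t`, at a vertex of type `t'`, is mapped to an edge of the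
Möbius–Kantor graph. The two types agree if this vertex corresponds to the term of the flag; otherwise
the labels at this corner do not depend on `t`. -/
theorem linkCoord_adj (t t' : Bool) (h : LocalFlag) (ht : h.rot.origin = 0 → t = t') :
    moebiusKantor.Adj (linkCoord t' (h.label t, !h.2)) (linkCoord t' (h.rot.label t, h.2)) := by
  revert t t' h
  decide +kernel

/-- Every edge of the Möbius–Kantor graph comes from the corner of a local flag. -/
theorem exists_corner (t : Bool) (s : EdgeLabel × Bool) (j : Fin 3) :
    ∃ h : LocalFlag, ∀ t', (h.rot.origin = 0 → t' = t) →
      (h.label t', !h.2) = s ∧ linkCoord t (h.rot.label t', h.2) = mkNeighbor (linkCoord t s) j := by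
  revert t s j
  decide +kernel

end LocalFlag

namespace necklace

open TriangleComplex

variable {N : ℕ} {c : ZMod N → Bool}

theorem src_edge (f : (necklace c).Flag) :
    (necklace c).src ((necklace c).edge f) = (f.1 + (f.2.origin : ZMod N) : ZMod N) := by
  rw [f.2.origin_eq (c f.1), Int.cast_sub, ← add_sub_assoc]
  rfl

/-- An edge is determined by its origin, its label and its orientation. -/
theorem dart_ext {d d' : (necklace c).Dart} (h : (necklace c).src d = (necklace c).src d')
    (hs : (d.1.2, d.2) = (d'.1.2, d'.2)) : d = d' := by
  obtain ⟨⟨i, l⟩, b⟩ := d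
  obtain ⟨⟨i', l'⟩, b'⟩ := d'
  obtain ⟨rfl, rfl⟩ := Prod.ext_iff.1 hs
  obtain rfl : i = i' := sub_left_injective h
  rfl

/-! ### Links of the glued complexes -/

/-- The links of the glued complexes are isomorphic to the Möbius–Kantor graph. -/
theorem isComponentIso (v : ZMod N) :
    SimpleGraph.IsComponentIso (necklace c).linkGraph moebiusKantor {d | (necklace c).src d = v}
      fun d => linkCoord (c v) (d.1.2, d.2) where
  injOn d hd d' hd' h := dart_ext (hd.trans (Eq.symm hd')) (linkCoord_injective _ h)
  mem_of_adj := by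
    rintro _ _ ha ⟨-, f, rfl, rfl⟩
    exact ((necklace c).src_edge_rot f).trans ha
  map_adj := by
    rintro _ _ ha ⟨-, f, rfl, rfl⟩
    refine f.2.linkCoord_adj (c f.1) (c v) fun h0 => ?_
    have h1 := ((necklace c).src_edge_rot f).trans ha
    have h2 : f.1 + (f.2.rot.origin : ZMod N) = v := (src_edge ((necklace c).rot f)).symm.trans h1
    rw [h0, Int.cast_zero, add_zero] at h2
    rw [h2]
  lift_adj := by
    rintro a w ha hw
    obtain ⟨j, rfl⟩ := (moebiusKantor_adj_iff _ _).1 hw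
    obtain ⟨h, hh⟩ := LocalFlag.exists_corner (c v) (a.1.2, a.2) j
    let f : (necklace c).Flag := (v - (h.rot.origin : ZMod N), h)
    obtain ⟨h1, h2⟩ := hh (c (v - (h.rot.origin : ZMod N))) (fun h0 => by simp [h0])
    have hsrc : (necklace c).src ((necklace c).edge ((necklace c).rot f)) = v :=
      (src_edge ((necklace c).rot f)).trans (sub_add_cancel (G := ZMod N) v (h.rot.origin : ZMod N))
    have e : (necklace c).rev ((necklace c).edge f) = a :=
      dart_ext (((necklace c).src_edge_rot f).symm.trans (hsrc.trans (Eq.symm ha))) h1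
    refine ⟨(necklace c).edge ((necklace c).rot f), ⟨?_, f, e, rfl⟩, h2⟩
    rintro rfl
    exact hw.ne h2

theorem isRankSevenFourths : (necklace c).IsRankSevenFourths where
  no_loop f h := by
    have h2 : (!f.2.2) = f.2.2 := congrArg Prod.snd h
    simp at h2
  no_multiple f g h1 h2 := by
    obtain ⟨w, h⟩ := f
    obtain ⟨w', h'⟩ := g
    have e1 : w + (h.pos : ZMod N) = w' + (h'.pos : ZMod N) := congrArg (fun d => d.1.1) h1
    have e2 : w + (h.rot.pos : ZMod N) = w' + (h'.rot.pos : ZMod N) := congrArg (fun d => d.1.1) h2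
    obtain ⟨hpos, hh⟩ := LocalFlag.eq_of_label_eq (c w) (c w') h h' (congrArg (fun d => d.1.2) h1)
      (congrArg (fun d => d.2) h1) (congrArg (fun d => d.1.2) h2)
    obtain rfl : w = w' := by
      rcases hpos with hpos | hpos
      · rw [hpos] at e1
        exact add_right_cancel e1
      · rw [hpos] at e2
        exact add_right_cancel e2
    rw [hh rfl]
  link_iso := fun v : ZMod N => by
    obtain ⟨e⟩ := (isComponentIso (c := c) v).nonempty_iso (B := Set.univ) <| by
      refine Set.eq_univ_of_forall fun m => ?_
      obtain ⟨⟨l, b⟩, rfl⟩ := linkCoord_surjective (c v) m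
      exact ⟨((v + (leaves (l, b) : ZMod N), l), b), add_sub_cancel_right v _, rfl⟩
    exact ⟨e.trans moebiusKantor.induceUnivIso⟩

/-- A function on the edges which agrees along the corners of the faces depends only on the origin of
the edges, since the links are connected. -/
theorem eq_of_src_eq {S : Type} (σ : (necklace c).Dart → S)
    (hσ : ∀ f, σ ((necklace c).edge ((necklace c).rot f)) =
      σ ((necklace c).rev ((necklace c).edge f)))
    {d d' : (necklace c).Dart} (h : (necklace c).src d = (necklace c).src d') : σ d = σ d' := by
  set v := (necklace c).src d with hv
  have hiso := isComponentIso (c := c) v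
  have key : ∀ k : ℕ, ∃ b, (necklace c).src b = v ∧
      linkCoord (c v) (b.1.2, b.2) = linkCoord (c v) (d.1.2, d.2) + k ∧ σ b = σ d := by
    intro k
    induction k with
    | zero => exact ⟨d, rfl, by simp, rfl⟩
    | succ k ih =>
      obtain ⟨b, hb, hk, hs⟩ := ih
      obtain ⟨b', hadj, hb'⟩ := hiso.lift_adj hb ((moebiusKantor_adj_iff _ _).2 ⟨0, rfl⟩)
      refine ⟨b', hiso.mem_of_adj hb hadj, ?_, ?_⟩
      · rw [hb']
        simp only [mkNeighbor, Matrix.cons_val_zero, hk]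
        push_cast
        ring
      · obtain ⟨-, f, rfl, rfl⟩ := hadj
        rw [hσ, hs]
  obtain ⟨b, hb, hk, hs⟩ := key (linkCoord (c v) (d'.1.2, d'.2) - linkCoord (c v) (d.1.2, d.2)).val
  rw [ZMod.natCast_val, ZMod.cast_id, add_sub_cancel] at hk
  rw [← hs, hiso.injOn hb h.symm hk]

end necklace

/-! ### The glued complexes in coordinates -/

/-- The cobordism `X₀₀` (for `true`) or `Y₀₀` (for `false`). -/
def cobordismOf (t : Bool) : Cobordism CobordismEdge := if t then cobordismX else cobordismY

namespace GluedEdge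

variable {N : ℕ} {c : ZMod N → Bool}

/-- The inclusion of the representatives in the labels of a term. -/
def incl : EdgeLabel → CobordismEdge
  | .a => .a | .b => .b | .c => .c | .d => .d
  | .e1 => .e1 | .e2 => .e2 | .e3 => .e3 | .e4 => .e4

/-- The edge of the composition with given coordinates. -/
def ofCoord (c : ZMod N → Bool) (p : ZMod N × EdgeLabel) : GluedEdge fun i => cobordismOf (c i) :=
  Quot.mk _ (p.1, incl p.2)

/-- The coordinates of an edge of a term. -/
def coordAux (c : ZMod N → Bool) (i : ZMod N) : CobordismEdge → ZMod N × EdgeLabel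
  | .a => (i, .a) | .b => (i, .b) | .c => (i, .c) | .d => (i, .d)
  | .e1 => (i, .e1) | .e2 => (i, .e2) | .e3 => (i, .e3) | .e4 => (i, .e4)
  | .a' => (i + 1, .a) | .b' => (i + 1, .b) | .c' => (i + 1, .c) | .d' => (i + 1, .d)
  | .x => (i - 1, coreLabel (c (i - 1)) 0 0)
  | .y => (i - 1, coreLabel (c (i - 1)) 1 0)
  | .z => (i - 1, coreLabel (c (i - 1)) 2 0)
  | .x' => (i + 1, coreLabel (c (i + 1)) 3 0)
  | .y' => (i + 1, coreLabel (c (i + 1)) 4 0)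
  | .z' => (i + 1, coreLabel (c (i + 1)) 5 0)

/-- The left collar in terms of the representatives, and of the edges `x`, `y`, `z`, which belong to the
preceding term. -/
theorem cobordismOf_left (t : Bool) :
    (cobordismOf t).left .x = .x ∧ (cobordismOf t).left .y = .y ∧
      (cobordismOf t).left .z = .z ∧ (cobordismOf t).left .a = .a ∧ (cobordismOf t).left .b = .b ∧
      (cobordismOf t).left .c = .c ∧ (cobordismOf t).left .d = .d ∧
      (cobordismOf t).left .x' = incl (coreLabel t 3 0) ∧
      (cobordismOf t).left .y' = incl (coreLabel t 4 0) ∧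
      (cobordismOf t).left .z' = incl (coreLabel t 5 0) := by
  cases t <;> exact ⟨rfl, rfl, rfl, rfl, rfl, rfl, rfl, rfl, rfl, rfl⟩

/-- The right collar in terms of the representatives, and of the edges that belong to the following
term. -/
theorem cobordismOf_right (t : Bool) :
    (cobordismOf t).right .x' = .x' ∧ (cobordismOf t).right .y' = .y' ∧
      (cobordismOf t).right .z' = .z' ∧ (cobordismOf t).right .a = .a' ∧
      (cobordismOf t).right .b = .b' ∧ (cobordismOf t).right .c = .c' ∧
      (cobordismOf t).right .d = .d' ∧
      (cobordismOf t).right .x = incl (coreLabel t 0 0) ∧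
      (cobordismOf t).right .y = incl (coreLabel t 1 0) ∧
      (cobordismOf t).right .z = incl (coreLabel t 2 0) := by
  cases t <;> exact ⟨rfl, rfl, rfl, rfl, rfl, rfl, rfl, rfl, rfl, rfl⟩

theorem coordAux_incl (i : ZMod N) (l : EdgeLabel) : coordAux c i (incl l) = (i, l) := by
  cases l <;> rfl

theorem coordAux_right (i : ZMod N) (s : CollarEdge) :
    coordAux c i ((cobordismOf (c i)).right s) =
      coordAux c (i + 1) ((cobordismOf (c (i + 1))).left s) := by
  have e : i + 1 - 1 = i := add_sub_cancel_right i 1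
  obtain ⟨l1, l2, l3, l4, l5, l6, l7, l8, l9, l10⟩ := cobordismOf_left (c (i + 1))
  obtain ⟨r1, r2, r3, r4, r5, r6, r7, r8, r9, r10⟩ := cobordismOf_right (c i)
  cases s with
  | x => rw [l1, r8, coordAux_incl, coordAux, e]
  | y => rw [l2, r9, coordAux_incl, coordAux, e]
  | z => rw [l3, r10, coordAux_incl, coordAux, e]
  | x' => rw [l8, r1, coordAux_incl, coordAux]
  | y' => rw [l9, r2, coordAux_incl, coordAux]
  | z' => rw [l10, r3, coordAux_incl, coordAux]
  | a => rw [l4, r4, coordAux, coordAux]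
  | b => rw [l5, r5, coordAux, coordAux]
  | c => rw [l6, r6, coordAux, coordAux]
  | d => rw [l7, r7, coordAux, coordAux]

/-- The coordinates of an edge of the composition. -/
def coord : (GluedEdge fun i => cobordismOf (c i)) → ZMod N × EdgeLabel :=
  Quot.lift (fun p => coordAux c p.1 p.2) <| by
    rintro _ _ ⟨i, s, rfl, rfl⟩
    exact coordAux_right i s

theorem coord_ofCoord (p : ZMod N × EdgeLabel) : coord (ofCoord c p) = p := by
  obtain ⟨i, l⟩ := p
  cases l <;> rfl

theorem glue (i : ZMod N) (s : CollarEdge) :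
    (Quot.mk _ (i, (cobordismOf (c i)).right s) : GluedEdge fun i => cobordismOf (c i)) =
      Quot.mk _ (i + 1, (cobordismOf (c (i + 1))).left s) :=
  Quot.sound ⟨i, s, rfl, rfl⟩

theorem glue_sub_one (i : ZMod N) (s : CollarEdge) :
    (Quot.mk _ (i - 1, (cobordismOf (c (i - 1))).right s) : GluedEdge fun i => cobordismOf (c i)) =
      Quot.mk _ (i, (cobordismOf (c i)).left s) := by
  rw [glue, sub_add_cancel]

theorem ofCoord_coord (e : GluedEdge fun i => cobordismOf (c i)) : ofCoord c (coord e) = e := by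
  obtain ⟨i, l⟩ := e
  change ofCoord c (coordAux c i l) = _
  have hn := fun s => glue (c := c) i s
  have hp := fun s => glue_sub_one (c := c) i s
  obtain ⟨l1, l2, l3, -⟩ := cobordismOf_left (c i)
  obtain ⟨-, -, -, l4, l5, l6, l7, l8, l9, l10⟩ := cobordismOf_left (c (i + 1))
  obtain ⟨r1, r2, r3, r4, r5, r6, r7, -⟩ := cobordismOf_right (c i)
  obtain ⟨-, -, -, -, -, -, -, r8, r9, r10⟩ := cobordismOf_right (c (i - 1))
  cases l with
  | x => have := hp .x; rwa [l1, r8] at this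
  | y => have := hp .y; rwa [l2, r9] at this
  | z => have := hp .z; rwa [l3, r10] at this
  | x' => have := (hn .x').symm; rwa [l8, r1] at this
  | y' => have := (hn .y').symm; rwa [l9, r2] at this
  | z' => have := (hn .z').symm; rwa [l10, r3] at this
  | a' => have := (hn .a).symm; rwa [l4, r4] at this
  | b' => have := (hn .b).symm; rwa [l5, r5] at this
  | c' => have := (hn .c).symm; rwa [l6, r6] at this
  | d' => have := (hn .d).symm; rwa [l7, r7] at this
  | _ => rfl

/-- The `k`-th face along the term `w`. -/
def face (c : ZMod N → Bool) (w : ZMod N) (k : Fin 8) :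
    Fin 3 → GluedEdge fun i => cobordismOf (c i) :=
  fun i => ofCoord c (w + (corePos k i : ZMod N), coreLabel (c w) k i)

theorem eq_face {t : Fin 3 → GluedEdge fun i => cobordismOf (c i)} {w : ZMod N} {k : Fin 8}
    (h : ∀ j, coord (t j) = (w + (corePos k j : ZMod N), coreLabel (c w) k j)) : t = face c w k :=
  funext fun j => by rw [face, ← h, ofCoord_coord]

theorem face_injective {w w' : ZMod N} {k k' : Fin 8} (h : face c w k = face c w' k') :
    w = w' ∧ k = k' := by
  have h1 : ∀ i, (w + (corePos k i : ZMod N), coreLabel (c w) k i) =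
      (w' + (corePos k' i : ZMod N), coreLabel (c w') k' i) := by
    intro i
    rw [← coord_ofCoord (c := c) (_, _), ← coord_ofCoord (c := c) (w' + _, _)]
    exact congrArg coord (congrFun h i)
  obtain rfl : w = w' := by simpa [corePos] using congrArg Prod.fst (h1 0)
  have key : ∀ t k k', (∀ i, coreLabel t k i = coreLabel t k' i) → k = k' := by decide +kernel
  exact ⟨rfl, key _ _ _ fun i => congrArg Prod.snd (h1 i)⟩

/-- The triangles of a term, in the order of `coreLabel`. -/
def coreEdge (t : Bool) : Fin 8 → Fin 3 → CobordismEdge :=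
  if t then ![![.e2, .a', .d'], ![.e4, .c', .d'], ![.e3, .c', .b'], ![.e4, .d, .a], ![.e3, .b, .a],
      ![.e2, .b, .c], ![.e1, .e1, .e2], ![.e1, .e3, .e4]]
  else ![![.e4, .a', .d'], ![.e2, .c', .d'], ![.e1, .c', .b'], ![.e1, .d, .a], ![.e3, .b, .a],
      ![.e4, .b, .c], ![.e1, .e2, .e3], ![.e2, .e4, .e3]]

theorem coreEdge_mem (t : Bool) (k : Fin 8) : coreEdge t k ∈ (cobordismOf t).faces := by
  cases t <;> fin_cases k <;> simp [coreEdge, cobordismOf, cobordismX, cobordismY]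

theorem coordAux_coreEdge (w : ZMod N) (k : Fin 8) (i : Fin 3) :
    coordAux c w (coreEdge (c w) k i) = (w + (corePos k i : ZMod N), coreLabel (c w) k i) := by
  cases h : c w <;> fin_cases k <;> fin_cases i <;> simp [coreEdge, coordAux, corePos, coreLabel]

theorem mk_coreEdge (w : ZMod N) (k : Fin 8) :
    (fun i => (Quot.mk _ (w, coreEdge (c w) k i) : GluedEdge fun i => cobordismOf (c i))) =
      face c w k :=
  eq_face fun i => coordAux_coreEdge w k i

/-- Every triangle of a term is a face along this term or an adjacent one. -/
theorem exists_eq_face (i : ZMod N) (u : Fin 3 → CobordismEdge) (hu : u ∈ (cobordismOf (c i)).faces) :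
    ∃ w k, (fun j => (Quot.mk _ (i, u j) : GluedEdge fun i => cobordismOf (c i))) = face c w k := by
  suffices h : ∃ w k, ∀ j, coordAux c i (u j) = (w + (corePos k j : ZMod N), coreLabel (c w) k j) by
    obtain ⟨w, k, h⟩ := h
    exact ⟨w, k, eq_face h⟩
  have hu : u = ![.x, .a, .d] ∨ u = ![.y, .c, .d] ∨ u = ![.z, .c, .b] ∨ u = ![.x', .d', .a'] ∨
      u = ![.y', .b', .a'] ∨ u = ![.z', .b', .c'] ∨ ∃ k, u = coreEdge (c i) k := by
    cases h : c i <;> rw [h] at hu <;>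
    · obtain h | h | h | h | h | h | h | h | h | h | h | h | h | h := hu <;>
      first
        | exact .inl h
        | exact .inr (.inl h)
        | exact .inr (.inr (.inl h))
        | exact .inr (.inr (.inr (.inl h)))
        | exact .inr (.inr (.inr (.inr (.inl h))))
        | exact .inr (.inr (.inr (.inr (.inr (.inl h)))))
        | exact .inr (.inr (.inr (.inr (.inr (.inr ⟨0, h⟩)))))
        | exact .inr (.inr (.inr (.inr (.inr (.inr ⟨1, h⟩)))))
        | exact .inr (.inr (.inr (.inr (.inr (.inr ⟨2, h⟩)))))
        | exact .inr (.inr (.inr (.inr (.inr (.inr ⟨3, h⟩)))))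
        | exact .inr (.inr (.inr (.inr (.inr (.inr ⟨4, h⟩)))))
        | exact .inr (.inr (.inr (.inr (.inr (.inr ⟨5, h⟩)))))
        | exact .inr (.inr (.inr (.inr (.inr (.inr ⟨6, h⟩)))))
        | exact .inr (.inr (.inr (.inr (.inr (.inr ⟨7, h⟩)))))
  obtain rfl | rfl | rfl | rfl | rfl | rfl | ⟨k, rfl⟩ := hu
  · refine ⟨i - 1, 0, fun j => ?_⟩
    fin_cases j <;> cases h : c (i - 1) <;> simp [coordAux, corePos, coreLabel, h]
  · refine ⟨i - 1, 1, fun j => ?_⟩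
    fin_cases j <;> cases h : c (i - 1) <;> simp [coordAux, corePos, coreLabel, h]
  · refine ⟨i - 1, 2, fun j => ?_⟩
    fin_cases j <;> cases h : c (i - 1) <;> simp [coordAux, corePos, coreLabel, h]
  · refine ⟨i + 1, 3, fun j => ?_⟩
    fin_cases j <;> cases h : c (i + 1) <;> simp [coordAux, corePos, coreLabel, h]
  · refine ⟨i + 1, 4, fun j => ?_⟩
    fin_cases j <;> cases h : c (i + 1) <;> simp [coordAux, corePos, coreLabel, h]
  · refine ⟨i + 1, 5, fun j => ?_⟩
    fin_cases j <;> cases h : c (i + 1) <;> simp [coordAux, corePos, coreLabel, h]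
  · exact ⟨i, k, coordAux_coreEdge i k⟩

end GluedEdge

namespace necklace

open TriangleComplex GluedEdge

variable {N : ℕ} {c : ZMod N → Bool}

/-- The isomorphism to the composition, on flags. -/
def toFlag (f : (necklace c).Flag) : (closedComposition fun i => cobordismOf (c i)).Flag :=
  ((⟨face c f.1 f.2.1.1, f.1, coreEdge (c f.1) f.2.1.1, coreEdge_mem _ _,
    (mk_coreEdge f.1 f.2.1.1).symm⟩, f.2.1.2), f.2.2)

/-- The isomorphism to the composition, on oriented edges. -/
def toDart (d : (necklace c).Dart) : (closedComposition fun i => cobordismOf (c i)).Dart :=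
  (ofCoord c d.1, d.2)

/-- The identifications of vertices in the composition connect all edges with the same origin. -/
theorem src_toDart {d d' : (necklace c).Dart} (h : (necklace c).src d = (necklace c).src d') :
    (closedComposition fun i => cobordismOf (c i)).src (toDart d) =
      (closedComposition fun i => cobordismOf (c i)).src (toDart d') :=
  eq_of_src_eq (fun d => (closedComposition fun i => cobordismOf (c i)).src (toDart d))
    (fun f => (closedComposition fun i => cobordismOf (c i)).src_edge_rot (toFlag f)) h

/-- The isomorphism from the explicit model to the composition. -/
def toComposition (c : ZMod N → Bool) :
    Hom (necklace c) (closedComposition fun i => cobordismOf (c i)) where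
  vert v := (closedComposition fun i => cobordismOf (c i)).src (ofCoord c (v, .e1), true)
  dart := toDart
  flag := toFlag
  src_dart d := src_toDart (d := d) (d' := (((necklace c).src d, .e1), true)) <| by
    simp [necklace, leaves]
  rev_dart _ := rfl
  edge_flag _ := rfl
  rot_flag _ := rfl
  flip_flag _ := rfl

theorem toComposition_dart_bijective : (toComposition c).dart.Bijective := by
  constructor
  · rintro ⟨p, b⟩ ⟨p', b'⟩ h
    refine Prod.ext ?_ (congrArg (fun d => d.2) h)
    have h1 := congrArg (fun d => coord d.1) h
    simpa only [toComposition, toDart, coord_ofCoord] using h1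
  · rintro ⟨e, b⟩
    exact ⟨(coord e, b), Prod.ext (ofCoord_coord e) rfl⟩

theorem toComposition_flag_bijective : (toComposition c).flag.Bijective := by
  constructor
  · rintro ⟨w, ⟨k, i⟩, b⟩ ⟨w', ⟨k', i'⟩, b'⟩ h
    obtain ⟨rfl, rfl⟩ := face_injective (congrArg (fun f => f.1.1.1) h)
    obtain rfl : i = i' := congrArg (fun f => f.1.2) h
    obtain rfl : b = b' := congrArg (fun f => f.2) h
    rfl
  · rintro ⟨⟨⟨t, i, u, hu, rfl⟩, j⟩, b⟩
    obtain ⟨w, k, h⟩ := exists_eq_face i u hu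
    exact ⟨(w, (k, j), b), Prod.ext (Prod.ext (Subtype.ext h.symm) rfl) rfl⟩

theorem toComposition_vert_bijective : (toComposition c).vert.Bijective := by
  constructor
  · let back : (closedComposition fun i => cobordismOf (c i)).Vert → ZMod N :=
      Quot.lift (fun d => (necklace c).src (coord d.1, d.2)) <| by
        rintro _ _ ⟨_, ⟨i, u, hu, rfl⟩, j, rfl, rfl⟩
        obtain ⟨w, k, h⟩ := exists_eq_face i u hu
        have h' := fun j => congrFun h j
        simp only [h', face, coord_ofCoord]
        exact ((necklace c).src_edge_rot (w, (k, j), true)).symm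
    refine Function.LeftInverse.injective (g := back) fun v => ?_
    change (necklace c).src (coord (ofCoord c (v, .e1)), true) = v
    rw [coord_ofCoord]
    simp [necklace, leaves]
  · rintro ⟨e, b⟩
    exact ⟨_, ((toComposition c).src_dart (coord e, b)).symm.trans
      (congrArg (fun e => (closedComposition fun i => cobordismOf (c i)).src (e, b))
        (ofCoord_coord e))⟩

theorem surgeryComplex_eq (n : ℕ) :
    surgeryComplex n = closedComposition fun i : ZMod (2 * n + 1) => cobordismOf (decide (i = 0)) := by
  unfold surgeryComplex cobordismOf
  simp

end necklace

/-! ### Parity of the faces -/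

namespace TriangleComplex

variable {K : TriangleComplex}

theorem TwoTriangle.side_adj (hK : ∀ f, K.rev (K.edge f) ≠ K.edge (K.rot f)) {f : K.Flag}
    (T : K.TwoTriangle f) (i : Fin 3) : K.linkGraph.Adj (T.side i 0) (T.side i 1) ∧
      K.linkGraph.Adj (T.side i 1) (T.side i 2) ∧ K.linkGraph.Adj (T.side i 2) (T.side i 3) := by
  have key : ∀ g, K.linkGraph.Adj (K.rev (K.edge g)) (K.edge (K.rot g)) :=
    fun g => ⟨hK g, g, rfl, rfl⟩
  obtain ⟨⟨g, h1, h2⟩, ⟨g', h3, h4⟩, ⟨g'', h5, h6⟩⟩ := T.side_corner i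
  exact ⟨h1 ▸ h2 ▸ (key g).symm, h3 ▸ h4 ▸ key g', h5 ▸ h6 ▸ (key g'').symm⟩

end TriangleComplex

theorem even_ncard_fin_three_iff (B : Fin 3 → Bool) :
    Even (Set.ncard {i | B i = true}) ↔ (B 0 ^^ B 1 ^^ B 2) = false := by
  rw [Set.ncard_eq_toFinset_card']
  revert B
  decide

namespace LocalFlag

/-- The label of the first edge of a side of a 2-triangle, given by the outer face `h` at this end. -/
def firstLabel (t : Bool) (h : LocalFlag) : EdgeLabel × Bool := (h.rot.label t, h.2)

/-- The label of the last edge of a side of a 2-triangle, given by the outer face `h` at this end. -/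
def lastLabel (t : Bool) (h : LocalFlag) : EdgeLabel × Bool := (h.rot.rot.label t, !h.2)

/-- The faces along a side of `h` lie along a term which corresponds to a vertex of `h`. -/
theorem pos_sub_pos (t t' : Bool) (h h' : LocalFlag) (h1 : h'.label t' = h.label t)
    (h2 : h'.2 = h.2) : h.pos - h'.pos = h.origin ∨ h.pos - h'.pos = h.rot.origin ∨
      h.pos - h'.pos = h.rot.rot.origin := by
  revert t t' h h'
  decide +kernel

theorem origin_eq_zero (h : LocalFlag) :
    h.origin = 0 ∨ h.rot.origin = 0 ∨ h.rot.rot.origin = 0 := by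
  revert h
  decide +kernel

set_option synthInstance.maxSize 2000 in
/-- A 2-triangle whose faces lie along terms `Y₀₀` has an even number of roots of rank 2. -/
theorem parity_false (h h₀ : LocalFlag) (e₀ : h₀.label false = h.label false ∧ h₀.2 = h.2 ∧ h₀ ≠ h)
    (h₁ : LocalFlag) (e₁ : h₁.label false = h.rot.label false ∧ h₁.2 = h.2 ∧ h₁ ≠ h.rot)
    (h₂ : LocalFlag) (e₂ : h₂.label false = h.rot.rot.label false ∧ h₂.2 = h.2 ∧ h₂ ≠ h.rot.rot) :
    (mkTriple (linkCoord false (h₀.firstLabel false)) (linkCoord false (h₁.lastLabel false)) ^^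
      mkTriple (linkCoord false (h₁.firstLabel false)) (linkCoord false (h₂.lastLabel false)) ^^
      mkTriple (linkCoord false (h₂.firstLabel false)) (linkCoord false (h₀.lastLabel false))) =
      false := by
  have key : ∀ h h₀ : LocalFlag, h₀.label false = h.label false ∧ h₀.2 = h.2 ∧ h₀ ≠ h →
      ∀ h₁ : LocalFlag, h₁.label false = h.rot.label false ∧ h₁.2 = h.2 ∧ h₁ ≠ h.rot →
      ∀ h₂ : LocalFlag, h₂.label false = h.rot.rot.label false ∧ h₂.2 = h.2 ∧ h₂ ≠ h.rot.rot →
      (mkTriple (linkCoord false (h₀.firstLabel false)) (linkCoord false (h₁.lastLabel false)) ^^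
        mkTriple (linkCoord false (h₁.firstLabel false)) (linkCoord false (h₂.lastLabel false)) ^^
        mkTriple (linkCoord false (h₂.firstLabel false)) (linkCoord false (h₀.lastLabel false))) =
        false := by
    decide +kernel
  exact key h h₀ e₀ h₁ e₁ h₂ e₂

end LocalFlag

namespace necklace

open TriangleComplex

variable {N : ℕ} {c : ZMod N → Bool}

/-- The parity of a 2-triangle in coordinates, where `t i` is the type of the midpoint of the `i`-th
side. -/
theorem even_numRankTwo_iff {f : (necklace c).Flag} (T : (necklace c).TwoTriangle f)
    (t : Fin 3 → Bool) (ht : ∀ i, c ((necklace c).src (T.side i 1)) = t i) :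
    Even T.numRankTwo ↔
      (mkTriple (linkCoord (t 0) ((T.outer 0).2.firstLabel (c (T.outer 0).1)))
          (linkCoord (t 0) ((T.outer 1).2.lastLabel (c (T.outer 1).1))) ^^
        mkTriple (linkCoord (t 1) ((T.outer 1).2.firstLabel (c (T.outer 1).1)))
          (linkCoord (t 1) ((T.outer 2).2.lastLabel (c (T.outer 2).1))) ^^
        mkTriple (linkCoord (t 2) ((T.outer 2).2.firstLabel (c (T.outer 2).1)))
          (linkCoord (t 2) ((T.outer 0).2.lastLabel (c (T.outer 0).1)))) = false := by
  let B (i : Fin 3) : Bool :=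
    mkTriple (linkCoord (t i) ((T.outer i).2.firstLabel (c (T.outer i).1)))
      (linkCoord (t i) ((T.outer (i + 1)).2.lastLabel (c (T.outer (i + 1)).1)))
  have key : ∀ i, (necklace c).linkGraph.IsRoot (T.side i) ∧
      (necklace c).linkGraph.rootRank (T.side i) = 2 ↔ B i = true := by
    intro i
    have hiso := isComponentIso (c := c) ((necklace c).src (T.side i 1))
    have hmem : ∀ j, T.side i j ∈ {d | (necklace c).src d = (necklace c).src (T.side i 1)} :=
      T.src_side i
    obtain ⟨a1, a2, a3⟩ := T.side_adj isRankSevenFourths.no_loop i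
    rw [← hiso.isRoot_comp hmem, ← hiso.rootRank_comp hmem, isRoot_moebiusKantor_iff, ht i]
    have b1 := hiso.map_adj (hmem 0) a1
    have b2 := hiso.map_adj (hmem 1) a2
    have b3 := hiso.map_adj (hmem 2) a3
    rw [ht i] at b1 b2 b3
    exact ⟨fun h => h.2.2.2, fun h => ⟨b1, b2, b3, h⟩⟩
  unfold TwoTriangle.numRankTwo
  simp only [key]
  exact even_ncard_fin_three_iff B

theorem src_side_one {f : (necklace c).Flag} (T : (necklace c).TwoTriangle f) (i : Fin 3) :
    (necklace c).src (T.side i 1) =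
      (f.1 + ((((necklace c).rot^[i] f).2.rot.origin : ℤ) : ZMod N) : ZMod N) := by
  have h : ((necklace c).rot^[i] f).1 = f.1 := by fin_cases i <;> rfl
  rw [← h]
  exact ((necklace c).src_edge_rot ((necklace c).rot^[i] f)).symm.trans (src_edge _)

/-- The faces whose vertices correspond to terms `Y₀₀` are even. -/
theorem isEvenFace (f : (necklace c).Flag) (h0 : c (f.1 + (f.2.origin : ZMod N)) = false)
    (h1 : c (f.1 + (f.2.rot.origin : ZMod N)) = false)
    (h2 : c (f.1 + (f.2.rot.rot.origin : ZMod N)) = false) :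
    (necklace c).IsEvenFace f := by
  intro T
  have h3 : f.2.rot.rot.rot = f.2 := f.2.rot_rot_rot
  have hf : c f.1 = false := by
    rcases f.2.origin_eq_zero with e | e | e
    · simpa [e] using h0
    · simpa [e] using h1
    · simpa [e] using h2
  have ht : ∀ i, c ((necklace c).src (T.side i 1)) = false := by
    intro i
    rw [src_side_one]
    fin_cases i
    · exact h1
    · exact h2
    · change c (f.1 + (f.2.rot.rot.rot.origin : ZMod N)) = false
      rwa [h3]
  -- The outer faces also lie along terms `Y₀₀`.
  have houter : ∀ i : Fin 3, ∀ g : LocalFlag, (necklace c).rot^[i] f = (f.1, g) →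
      (c (f.1 + (g.origin : ZMod N)) = false ∧ c (f.1 + (g.rot.origin : ZMod N)) = false ∧
        c (f.1 + (g.rot.rot.origin : ZMod N)) = false) → c (T.outer i).1 = false ∧
      (T.outer i).2.label false = g.label false ∧ (T.outer i).2.2 = g.2 ∧ (T.outer i).2 ≠ g := by
    intro i g hg hc
    have e := T.edge_outer i
    have hne := T.outer_ne i
    rw [hg] at e hne
    generalize T.outer i = o at e hne ⊢
    obtain ⟨w', g'⟩ := o
    have e1 : w' + (g'.pos : ZMod N) = f.1 + (g.pos : ZMod N) := congrArg (fun d => d.1.1) e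
    have e2 : g'.label (c w') = g.label (c f.1) := congrArg (fun d => d.1.2) e
    have e3 : g'.2 = g.2 := congrArg (fun d => d.2) e
    have e4 : w' = f.1 + ((g.pos - g'.pos : ℤ) : ZMod N) := by
      rw [Int.cast_sub, ← add_sub_assoc, ← e1, add_sub_cancel_right]
    have hw' : c w' = false := by
      rcases LocalFlag.pos_sub_pos _ _ _ _ e2 e3 with e5 | e5 | e5 <;> rw [e4, e5]
      exacts [hc.1, hc.2.1, hc.2.2]
    refine ⟨hw', ?_, e3, ?_⟩
    · rwa [hw', hf] at e2
    · rintro rfl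
      exact hne (Prod.ext (add_right_cancel e1) rfl)
  obtain ⟨c0, e0⟩ := houter 0 f.2 rfl ⟨h0, h1, h2⟩
  obtain ⟨c1, e1⟩ := houter 1 f.2.rot rfl ⟨h1, h2, by rwa [h3]⟩
  obtain ⟨c2, e2⟩ := houter 2 f.2.rot.rot rfl ⟨h2, by rwa [h3], by rwa [h3]⟩
  rw [even_numRankTwo_iff T (fun _ => false) ht, c0, c1, c2]
  exact LocalFlag.parity_false f.2 _ e0 _ e1 _ e2

/-- There are odd faces along a term `X₀₀`: the face `(y', b, a)` if the preceding term is `Y₀₀`, and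
the face `(z', b, c)` if it is `X₀₀`. -/
theorem exists_odd_face (w : ZMod N) (hw : c w = true) :
    ∃ f : (necklace c).Flag, ¬ (necklace c).IsEvenFace f := by
  cases hw' : c (w - 1) with
  | false =>
    let f : (necklace c).Flag := (w, ((4, 0), true))
    let T : (necklace c).TwoTriangle f :=
      { outer := ![(w, ((7, 1), true)), (w, ((5, 1), true)), (w, ((3, 2), true))]
        edge_outer := by
          intro i
          fin_cases i <;>
            simp [necklace, f, LocalFlag.rot, LocalFlag.pos, corePos, LocalFlag.label, hw, coreLabel]
        outer_ne := by
          intro i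
          fin_cases i <;> simp [necklace, f, LocalFlag.rot] }
    refine ⟨f, fun hf => ?_⟩
    have := (even_numRankTwo_iff T ![true, false, true] ?_).1 (hf T)
    · simp only [T, Matrix.cons_val, hw] at this
      revert this
      decide +kernel
    · intro i
      rw [src_side_one]
      fin_cases i
      · change c (w + ((0 : ℤ) : ZMod N)) = true
        rw [Int.cast_zero, add_zero, hw]
      · change c (w + ((-1 : ℤ) : ZMod N)) = false
        rw [Int.cast_neg, Int.cast_one, ← sub_eq_add_neg, hw']
      · change c (w + ((0 : ℤ) : ZMod N)) = true
        rw [Int.cast_zero, add_zero, hw]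
  | true =>
    let f : (necklace c).Flag := (w, ((5, 0), true))
    let T : (necklace c).TwoTriangle f :=
      { outer := ![(w, ((6, 2), true)), (w, ((4, 1), true)), ((w - 1 : ZMod N), ((1, 1), true))]
        edge_outer := by
          intro i
          fin_cases i <;>
            simp [necklace, f, LocalFlag.rot, LocalFlag.pos, corePos, LocalFlag.label, hw, hw', coreLabel]
        outer_ne := by
          intro i
          fin_cases i <;> simp [necklace, f, LocalFlag.rot] }
    refine ⟨f, fun hf => ?_⟩
    have := (even_numRankTwo_iff T ![true, true, true] ?_).1 (hf T)
    · simp only [T, Matrix.cons_val, hw, hw'] at this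
      revert this
      decide +kernel
    · intro i
      rw [src_side_one]
      fin_cases i
      · change c (w + ((0 : ℤ) : ZMod N)) = true
        rw [Int.cast_zero, add_zero, hw]
      · change c (w + ((-1 : ℤ) : ZMod N)) = true
        rw [Int.cast_neg, Int.cast_one, ← sub_eq_add_neg, hw']
      · change c (w + ((0 : ℤ) : ZMod N)) = true
        rw [Int.cast_zero, add_zero, hw]

end necklace

namespace necklace

open TriangleComplex

variable {N : ℕ} {c : ZMod N → Bool}

/-! ### Distances and the radius of evenness of the glued complexes -/

/-- Edges join a vertex to itself or to an adjacent one. -/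
theorem exists_eq_add_of_isPath {v u : ZMod N} {l : List (necklace c).Dart}
    (h : (necklace c).IsPath v l u) : ∃ j : ℤ, |j| ≤ l.length ∧ u = v + (j : ZMod N) := by
  induction l generalizing v with
  | nil =>
    have h1 : v = u := h
    exact ⟨0, by simp, by simpa using h1.symm⟩
  | cons d l ih =>
    obtain ⟨⟨i, s⟩, b⟩ := d
    obtain ⟨j, hj, hu⟩ := ih h.2
    have h1 : i - (leaves (s, b) : ZMod N) = v := h.1
    have h2 : u = i - (leaves (s, !b) : ZMod N) + (j : ZMod N) := hu
    have h3 : |leaves (s, b) - leaves (s, !b)| ≤ 1 := by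
      cases s <;> cases b <;> decide
    refine ⟨leaves (s, b) - leaves (s, !b) + j, ?_, ?_⟩
    · refine (abs_add_le _ _).trans ?_
      change _ ≤ ((l.length + 1 : ℕ) : ℤ)
      push_cast
      linarith
    · rw [h2, ← h1]
      push_cast
      ring

theorem exists_isPath [NeZero N] (v u : ZMod N) : ∃ l, (necklace c).IsPath v l u := by
  have key : ∀ k : ℕ, ∃ l, (necklace c).IsPath v l (v + (k : ZMod N) : ZMod N) := by
    intro k
    induction k with
    | zero =>
      rw [Nat.cast_zero, add_zero]
      exact ⟨[], rfl⟩
    | succ k ih =>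
      obtain ⟨l, hl⟩ := ih
      let d : (necklace c).Dart := ((v + (k : ZMod N) + 1, EdgeLabel.a), true)
      refine ⟨l ++ [d], hl.append (isPath_singleton.2 ⟨?_, ?_⟩)⟩
      · simp [d, necklace, leaves]
      · simp [d, necklace, leaves, add_assoc]
  obtain ⟨l, hl⟩ := key (u - v).val
  rw [ZMod.natCast_val, ZMod.cast_id, add_sub_cancel] at hl
  exact ⟨l, hl⟩

/-- If the terms at distance at most `r` from a vertex are copies of `Y₀₀`, then the balls of radius `r`
around the preimages of this vertex in a covering are even. -/
theorem isEvenBall {X : TriangleComplex} {p : Hom X (necklace c)} (hp : p.IsCovering) {x : X.Vert}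
    {v : ZMod N} (hx : p.vert x = v) {r : ℕ}
    (hc : ∀ j : ℤ, |j| ≤ r → c (v + (j : ZMod N)) = false) : X.IsEvenBall x r := by
  have key : ∀ f : X.Flag, X.src (X.edge f) ∈ X.ball x r →
      c ((p.flag f).1 + ((p.flag f).2.origin : ZMod N)) = false := by
    intro f hf
    obtain ⟨l, hl, hr⟩ := p.map_mem_ball hf
    rw [hx] at hl
    obtain ⟨j, hj, e⟩ := exists_eq_add_of_isPath hl
    rw [← p.src_dart, ← p.edge_flag, src_edge] at e
    rw [e]
    exact hc j (hj.trans (by exact_mod_cast hr))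
  intro f h0 h1 h2
  refine (hp.isEvenFace_iff f).1 (isEvenFace _ (key f h0) ?_ ?_)
  · have := key _ h1
    rwa [← p.rot_flag] at this
  · have := key _ h2
    rwa [← p.rot_flag, ← p.rot_flag] at this

/-- The coordinates of `surgeryComplex n`. -/
theorem exists_iso (n : ℕ) :
    ∃ q : Hom (surgeryComplex n) (necklace fun i : ZMod (2 * n + 1) => decide (i = 0)),
      q.vert.Bijective ∧ q.dart.Bijective ∧ q.flag.Bijective := by
  rw [surgeryComplex_eq]
  exact ⟨(toComposition _).symm toComposition_vert_bijective toComposition_dart_bijective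
    toComposition_flag_bijective, Equiv.bijective _, Equiv.bijective _, Equiv.bijective _⟩

end necklace

namespace TriangleComplex

theorem surgeryComplex_isCompact (n : ℕ) : (surgeryComplex n).IsCompact := by
  obtain ⟨q, hv, hd, hf⟩ := necklace.exists_iso n
  have : NeZero (2 * n + 1) := ⟨by omega⟩
  refine ⟨?_, ?_, ?_⟩
  · have : Finite (ZMod (2 * n + 1)) := inferInstance
    exact Finite.of_injective (β := ZMod (2 * n + 1)) q.vert hv.1
  · exact Finite.of_injective (β := (ZMod (2 * n + 1) × EdgeLabel) × Bool) q.dart hd.1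
  · exact Finite.of_injective (β := ZMod (2 * n + 1) × LocalFlag) q.flag hf.1

theorem surgeryComplex_isRankSevenFourths (n : ℕ) : (surgeryComplex n).IsRankSevenFourths := by
  obtain ⟨q, hv, hd, hf⟩ := necklace.exists_iso n
  exact (q.isCovering_of_bijective hv hd hf).isRankSevenFourths necklace.isRankSevenFourths

theorem surgeryComplex_connected (n : ℕ) (x y : (surgeryComplex n).Vert) :
    ∃ l, (surgeryComplex n).IsPath x l y := by
  obtain ⟨q, hv, hd, hf⟩ := necklace.exists_iso n
  have : NeZero (2 * n + 1) := ⟨by omega⟩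
  obtain ⟨l', hl'⟩ := necklace.exists_isPath (N := 2 * n + 1)
    (c := fun i => decide (i = 0)) (q.vert x) (q.vert y)
  obtain ⟨l, z, hl, -, hz⟩ := (q.isCovering_of_bijective hv hd hf).lift_path hl'
  exact ⟨l, hv.1 hz ▸ hl⟩

/-- The vertex opposite to the term `X₀₀` is the centre of an even ball of radius `n - 1`. -/
theorem le_evennessRadius_add_one (n : ℕ) (X : (surgeryComplex n).UniversalCover) :
    (n : ℕ∞) ≤ X.total.evennessRadius + 1 := by
  cases n with
  | zero => simp
  | succ n =>
    obtain ⟨q, hv, hd, hf⟩ := necklace.exists_iso (n + 1)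
    have hp := (q.isCovering_of_bijective hv hd hf).comp X.isCovering
    obtain ⟨x, hx⟩ := hp.surjective ((n + 1 : ℕ) : ZMod (2 * (n + 1) + 1))
    have : (n : ℕ∞) ≤ X.total.evennessRadius := by
      refine (necklace.isEvenBall hp hx fun j hj => ?_).le_evennessRadius
      rw [abs_le] at hj
      refine decide_eq_false fun h0 => ?_
      have h1 : (((n + 1 : ℕ) + j : ℤ) : ZMod (2 * (n + 1) + 1)) = 0 := by
        push_cast at h0 ⊢
        exact h0
      rw [ZMod.intCast_zmod_eq_zero_iff_dvd] at h1
      have := Int.le_of_dvd (by push_cast; omega) h1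
      push_cast at this
      omega
    push_cast
    gcongr

/-- Every ball of a large radius in a universal cover contains a lift of an odd face along the term
`X₀₀`. -/
theorem exists_forall_evennessRadius_le (n : ℕ) :
    ∃ D : ℕ, ∀ X : (surgeryComplex n).UniversalCover, X.total.evennessRadius ≤ D := by
  obtain ⟨q, hv, hd, hf⟩ := necklace.exists_iso n
  obtain ⟨f, hodd⟩ := necklace.exists_odd_face
    (c := fun i : ZMod (2 * n + 1) => decide (i = 0)) 0 (by simp)
  obtain ⟨f, rfl⟩ := hf.2 f
  rw [(q.isCovering_of_bijective hv hd hf).isEvenFace_iff] at hodd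
  have := (surgeryComplex_isCompact n).1
  obtain ⟨D, hD⟩ := exists_evennessRadius_le (surgeryComplex_connected n) hodd
  exact ⟨D, fun X => hD X.total X.proj X.isCovering⟩

end TriangleComplex

theorem le_add_one_of_radius_le {n D : ℕ} {e : ℕ∞} (h : e ≤ D) (h' : (n : ℕ∞) ≤ e + 1) :
    n ≤ D + 1 := by
  have : (n : ℕ∞) ≤ ((D + 1 : ℕ) : ℕ∞) := by
    refine h'.trans ?_
    push_cast
    gcongr
  exact_mod_cast this

theorem mainTheorem1 :
    (∀ n : ℕ, (surgeryComplex n).IsCompact ∧ (surgeryComplex n).IsRankSevenFourths) ∧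
    (∀ n : ℕ, Nonempty (surgeryComplex n).UniversalCover) ∧
    (∀ (n : ℕ) (X : (surgeryComplex n).UniversalCover),
      (n : ℕ∞) ≤ X.total.evennessRadius + 1 ∧ X.total.evennessRadius < ⊤) ∧
    ∃ S : Set ℕ, S.Infinite ∧ ∀ m ∈ S, ∀ n ∈ S, m ≠ n →
      ∀ (X : (surgeryComplex m).UniversalCover) (Y : (surgeryComplex n).UniversalCover),
        ¬ X.total.IsIsomorphic Y.total := by
  choose D hD using TriangleComplex.exists_forall_evennessRadius_le
  refine ⟨fun n => ⟨TriangleComplex.surgeryComplex_isCompact n,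
    TriangleComplex.surgeryComplex_isRankSevenFourths n⟩, fun n => ?_,
    fun n X => ⟨TriangleComplex.le_evennessRadius_add_one n X,
      (hD n X).trans_lt (ENat.natCast_lt_top _)⟩, ?_⟩
  · obtain ⟨q, hv, -, -⟩ := necklace.exists_iso n
    obtain ⟨x, -⟩ := hv.2 (0 : ZMod (2 * n + 1))
    exact TriangleComplex.nonempty_universalCover (TriangleComplex.surgeryComplex_connected n x)
  · -- Every term exceeds the bound for the radius of evenness of the preceding one by more than 1.
    let s : ℕ → ℕ := Nat.rec 0 fun _ m => max m (D m + 1) + 1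
    have hs : ∀ k, s (k + 1) = max (s k) (D (s k) + 1) + 1 := fun _ => rfl
    have hmono : StrictMono s := strictMono_nat_of_lt_succ fun k => by
      rw [hs]
      omega
    have key : ∀ k l, k < l → ∀ (X : (surgeryComplex (s k)).UniversalCover)
        (Y : (surgeryComplex (s l)).UniversalCover),
        X.total.evennessRadius ≠ Y.total.evennessRadius := by
      intro k l hkl X Y h
      have h3 := le_add_one_of_radius_le (hD _ X) (h ▸ TriangleComplex.le_evennessRadius_add_one (s l) Y)
      have h4 := hmono.monotone (Nat.succ_le_of_lt hkl)
      rw [Nat.succ_eq_add_one, hs] at h4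
      omega
    refine ⟨Set.range s, Set.infinite_range_of_injective hmono.injective, ?_⟩
    rintro _ ⟨k, rfl⟩ _ ⟨l, rfl⟩ hne X Y hXY
    have h := hXY.evennessRadius_eq
    rcases lt_trichotomy k l with hkl | rfl | hkl
    · exact key k l hkl X Y h
    · exact hne rfl
    · exact key l k hkl Y X h.symm
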